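/- For a lattice polytope $P\subset\mathbb{R}^d$ (the convex hull of a nonempty finite subset of $\mathbb{Z}^d$) of dimension $r$ and a homogeneous polynomial $w$ of degree $m$ on $\mathbb{R}^{d}\times\mathbb{R}$, the $h^*$-polynomial of $P$ with weight $w$ is the polynomial $h^*_{P,w}(t)$, of degree at most $r+m$, determined by $$\sum_{n\ge 0}\Big(\sum_{x\in nP\cap\mathbb{Z}^d} w(x,n)\Big)t^n=\frac{h^*_{P,w}(t)}{(1-t)^{r+m+1}} .$$ A weight on $\mathbb{R}^d$ is regarded as a weight on $\mathbb{R}^d\times\mathbb{R}$ that does not depend on the last coordinate. Similarly, the $h^2$-tensor polynomial of $P$ is the polynomial with coefficients $M_0,\dots,M_{r+2}\in\mathbb{R}^{d\times d}$ determined by $$\sum_{n\ge 0}\Big(\sum_{x\in nP\cap\mathbb{Z}^d} x x^{T}\Big)t^n=\frac{M_0+M_1t+\cdots+M_{r+2}t^{r+2}}{(1-t)^{r+3}} .$$ (1) For every (closed, convex, two-dimensional) lattice polygon $P\subset\mathbb{R}^2$ and every linear form $\ell$ on $\mathbb{R}^2$, or more generally on $\mathbb{R}^2\times\mathbb{R}$,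 the $h^*$-polynomial of $P$ with weight $w=\ell^2$ exists and has only nonnegative coefficients, whether or not $\ell$ changes sign on $P$ (respectively on $P\times\{1\}$). (2) For every $d$ and every lattice polytope $P\subset\mathbb{R}^d$, the following are equivalent: for every linear form $\ell$ on $\mathbb{R}^d$ the $h^*$-polynomial of $P$ with weight $\ell^2$ exists and has only nonnegative coefficients; the $h^2$-tensor polynomial of $P$ exists and all its coefficients are positive semidefinite matrices. In particular, for lattice polygons, statement (1) for linear forms on $\mathbb{R}^2$ is equivalent to the positive semidefiniteness of all coefficients of their $h^2$-tensor polynomials. -/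

import Mathlib

open scoped Pointwise

namespace WeightedEhrhart

/-- The point of `ℝ^d` given by an integer vector. -/
def latticePoint {d : ℕ} (x : Fin d → ℤ) : Fin d → ℝ := fun i => (x i : ℝ)

/-- A (nonempty) lattice polytope: the convex hull of finitely many integer points. -/
def IsLatticePolytope {d : ℕ} (P : Set (Fin d → ℝ)) : Prop :=
  ∃ S : Finset (Fin d → ℤ), S.Nonempty ∧ P = convexHull ℝ (latticePoint '' (S : Set (Fin d → ℤ)))

/-- The dimension of `P`, i.e. that of its affine hull. -/
noncomputable def polyDim {d : ℕ} (P : Set (Fin d → ℝ)) : ℕ :=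
  Module.finrank ℝ (vectorSpan ℝ P)

/-- A (closed, convex) lattice polygon: a two-dimensional lattice polytope in the plane. -/
def IsLatticePolygon (P : Set (Fin 2 → ℝ)) : Prop :=
  IsLatticePolytope P ∧ polyDim P = 2

/-- The integer points of the dilate `nP`. -/
def dilatePoints {d : ℕ} (P : Set (Fin d → ℝ)) (n : ℕ) : Set (Fin d → ℤ) :=
  {x | latticePoint x ∈ (n : ℝ) • P}

/-- The weighted Ehrhart series `∑ₙ (∑_{x ∈ nP ∩ ℤ^d} w(x, n)) tⁿ`, that is, the sum of
`w(y) t^(y_{d+1})` over the integer points `y = (x, n)` of the cone over `P × {1}`. The weight is a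
function on `ℝ^d × ℝ = ℝ^(d+1)`; a weight on `ℝ^d` is one that ignores the last coordinate.
(The inner sums are finite when `P` is bounded.) -/
noncomputable def ehrhartSeries {d : ℕ} (P : Set (Fin d → ℝ)) (w : (Fin d → ℝ) × ℝ → ℝ) :
    PowerSeries ℝ :=
  PowerSeries.mk fun n => ∑ᶠ x ∈ dilatePoints P n, w (latticePoint x, (n : ℝ))

/-- `h` is the `h*`-polynomial of the lattice polytope `P` with respect to the weight `w`,
homogeneous of degree `m`: `Ehr(P, w; t) = h(t) / (1 - t)^(dim P + m + 1)`, with `h` a polynomial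
of degree at most `dim P + m`. The equation determines `h`. -/
def IsHStarPolynomial {d : ℕ} (P : Set (Fin d → ℝ)) (w : (Fin d → ℝ) × ℝ → ℝ) (m : ℕ)
    (h : Polynomial ℝ) : Prop :=
  (h : PowerSeries ℝ) = (1 - PowerSeries.X) ^ (polyDim P + m + 1) * ehrhartSeries P w ∧
    h.natDegree ≤ polyDim P + m

/-- The series `∑ₙ L²(nP) tⁿ` of discrete moment tensors of rank two,
`L²(nP) = ∑_{x ∈ nP ∩ ℤ^d} x ⊗ x`, written as symmetric matrices `x xᵀ`. -/
noncomputable def momentTensorSeries {d : ℕ} (P : Set (Fin d → ℝ)) :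
    PowerSeries (Matrix (Fin d) (Fin d) ℝ) :=
  PowerSeries.mk fun n =>
    ∑ᶠ x ∈ dilatePoints P n, Matrix.vecMulVec (latticePoint x) (latticePoint x)

/-- `H` is the `h²`-tensor polynomial of `P`, the numerator of
`∑ₙ L²(nP) tⁿ = H(t) / (1 - t)^(dim P + 3)`. -/
def IsH2TensorPolynomial {d : ℕ} (P : Set (Fin d → ℝ))
    (H : Polynomial (Matrix (Fin d) (Fin d) ℝ)) : Prop :=
  (H : PowerSeries (Matrix (Fin d) (Fin d) ℝ)) =
      (1 - PowerSeries.X) ^ (polyDim P + 3) * momentTensorSeries P ∧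
    H.natDegree ≤ polyDim P + 2

end WeightedEhrhart

/-! For a polygon `P`, the sum of `ℓ²` over the lattice points of `nP` is a quartic polynomial `f n`
with `f 0 = 0`, and `f (-n)` is the same sum over the interior of `nP` (`isReciprocal_convexHull`).
Since fifth differences of `f` vanish, the numerator over `(1 - t)^5` is `f(1) t + (f(2) - 5 f(1))
t² + (f(-2) - 5 f(-1)) t³ + f(-1) t⁴` (`coe_quarticNumerator`). The outer coefficients are sums of
squares. The inner ones are nonnegative exactly when the sum over `2P` is at least five times the
sum over `P`, and likewise for interiors.

Doubled points `2x` account for four of the five copies, so it remains to dominate `∑ ℓ(x,1)²` by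
the squares at sums `u + v` not divisible by two (`HalvingClosed.sum_sq_le`,
`sum_sq_le_of_interior`). Points of positive value are translated by a maximizer `p`, or, if
congruent to `p` modulo two, by a nonnegative point `q` of another class; translation by a
nonnegative value only increases squares, and collisions are harmless because `p` is maximal
(`sum_sq_pos_add_le`). Negative points are treated in the same way. If no `q` exists, then `p` is
the only point of nonnegative value, and the surplus `2 f(p) f(q)` gained on the other side helps to
pay for it.

Quasi-explicit sums over simplicial cones give the polynomial and reciprocity for triangles and
segments; polygons follow by cutting along diagonals (`isReciprocal_of_cut`).

The tensor equivalence holds because `vᵀ M_k v` is the `k`-th coefficient for the weight `(v · x)²`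
(`quadValue_coeff`); symmetry turns vanishing of all these forms into vanishing of `M_k`. -/

namespace WeightedEhrhart

/-! ### Parity classes and the translation argument -/

section Halving

variable {G : Type*} [AddCommGroup G]

/-- `y` is twice an element. -/
def IsDouble (y : G) : Prop := ∃ m, y = m + m

lemma IsDouble.trans {u v w : G} (h₁ : IsDouble (u + v)) (h₂ : IsDouble (v + w)) :
    IsDouble (u + w) := by
  obtain ⟨m, hm⟩ := h₁
  obtain ⟨k, hk⟩ := h₂
  refine ⟨m + k - v, ?_⟩
  have : u + w = (u + v) + (v + w) - v - v := by abel
  rw [this, hm, hk]; abel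

lemma isDouble_add_self (u : G) : IsDouble (u + u) := ⟨u, rfl⟩

/-- The set contains the halves of all sums of its elements that are divisible by two. -/
def HalvingClosed (S : Finset G) : Prop := ∀ u ∈ S, ∀ v ∈ S, ∀ m, u + v = m + m → m ∈ S

-- Every positive `v` is sent to `v + p`, or to `v + q` when `v` and `p` are congruent modulo two,
-- so that the image is never a double. Each of the two translations is injective, so a target `y`
-- is hit at most twice, and then `(f v + f p)² ≥ f v² + f v'²` because `f v' ≤ f p`. The target `p
-- + q` moreover yields the cross term `2 f p f q`, kept as a surplus for
-- `HalvingClosed.sum_sq_le_of_neg`.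
open Classical in
lemma sum_sq_pos_add_le {S O : Finset G} {f F : G → ℝ} (hF : ∀ u v, F (u + v) = f u + f v)
    (hO : ∀ u ∈ S, ∀ v ∈ S, ¬ IsDouble (u + v) → u + v ∈ O)
    {p q : G} (hp : p ∈ S) (hq : q ∈ S) (hmax : ∀ v ∈ S, f v ≤ f p) (hp0 : 0 < f p)
    (hq0 : 0 ≤ f q) (hpq : ¬ IsDouble (p + q)) :
    ∑ v ∈ S with 0 < f v, f v ^ 2 + 2 * f p * f q ≤ ∑ y ∈ O with 0 < F y, F y ^ 2 := by
  set A := S.filter fun v => 0 < f v ∧ ¬ IsDouble (v + p) with hA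
  set B := S.filter fun v => 0 < f v ∧ IsDouble (v + p) with hB
  set T := O.filter fun y => 0 < F y with hT
  have hAB : ∑ v ∈ S with 0 < f v, f v ^ 2 = ∑ v ∈ A, f v ^ 2 + ∑ v ∈ B, f v ^ 2 := by
    rw [← Finset.sum_filter_add_sum_filter_not (S.filter fun v => 0 < f v)
      (fun v => ¬ IsDouble (v + p)), Finset.filter_filter, Finset.filter_filter]
    simp only [not_not, hA, hB]
  have hBq : ∀ v ∈ B, ¬ IsDouble (v + q) := by
    intro v hv h
    simp only [hB, Finset.mem_filter] at hv
    have h1 : IsDouble (p + v) := by rw [add_comm]; exact hv.2.2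
    exact hpq (h1.trans h)
  -- Both translated sums are rewritten over the common target set `T`, so that they can be compared
  -- term by term.
  have shift : ∀ (C : Finset G) (r : G), (∀ v ∈ C, v + r ∈ T) →
      ∑ v ∈ C, f v ^ 2 = ∑ y ∈ T, if y - r ∈ C then f (y - r) ^ 2 else 0 := by
    intro C r hC
    rw [← Finset.sum_filter]
    refine Finset.sum_bij' (fun v _ => v + r) (fun y _ => y - r) ?_ ?_ ?_ ?_ ?_
    · intro v hv; simp [hv, hC v hv]
    · intro y hy; exact (Finset.mem_filter.1 hy).2
    · intro v _; simp
    · intro y _; simp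
    · intro v _; simp
  have hAT : ∀ v ∈ A, v + p ∈ T := by
    intro v hv
    simp only [hA, Finset.mem_filter] at hv
    simp only [hT, Finset.mem_filter, hF]
    exact ⟨hO v hv.1 p hp hv.2.2, by linarith [hv.2.1]⟩
  have hBT : ∀ v ∈ B, v + q ∈ T := by
    intro v hv
    have hv' := hBq v hv
    simp only [hB, Finset.mem_filter] at hv
    simp only [hT, Finset.mem_filter, hF]
    exact ⟨hO v hv.1 q hq hv', by linarith [hv.2.1]⟩
  have hpqT : p + q ∈ T := by
    simp only [hT, Finset.mem_filter, hF]
    exact ⟨hO p hp q hq hpq, by linarith⟩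
  have hsur : 2 * f p * f q = ∑ y ∈ T, if y = p + q then 2 * f p * f q else 0 := by
    rw [Finset.sum_ite_eq' T (p + q)]; simp [hpqT]
  rw [hAB, shift A p hAT, shift B q hBT, hsur, ← Finset.sum_add_distrib, ← Finset.sum_add_distrib]
  refine Finset.sum_le_sum fun y hy => ?_
  have hy0 : 0 < F y := (Finset.mem_filter.1 hy).2
  have e1 : F y = f (y - p) + f p := by rw [← hF]; simp
  have e2 : F y = f (y - q) + f q := by rw [← hF]; simp
  by_cases h3 : y = p + q
  · subst h3
    rw [hF] at *
    simp only [add_sub_cancel_left, add_sub_cancel_right, if_true]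
    split_ifs <;> nlinarith [mul_nonneg hp0.le hq0]
  · rw [if_neg h3, add_zero]
    have h1 : y - p ∈ A → 0 < f (y - p) := fun h => (Finset.mem_filter.1 h).2.1
    have h2 : y - q ∈ B → 0 < f (y - q) ∧ f (y - q) ≤ f p := fun h =>
      ⟨(Finset.mem_filter.1 h).2.1, hmax _ (Finset.mem_filter.1 h).1⟩
    split_ifs with hc hd hd
    · have := h1 hc
      have := h2 hd
      rw [e1]; nlinarith
    · have := h1 hc
      rw [e1]; nlinarith
    · have := h2 hd
      rw [e2]; nlinarith
    · nlinarith

end Halving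

/-! ### Domination of squares in lattice-convex sets -/

section Plane

variable {d : ℕ}

/-- Take `p` maximizing `f`. If all points of nonnegative value are congruent to `p` modulo two,
then halving the distance to `p` stays inside this set, so a nearest such point other than `p`
cannot exist. -/
lemma HalvingClosed.pos_side {S : Finset (Fin d → ℤ)} (hS : HalvingClosed S)
    {f F : (Fin d → ℤ) → ℝ} (hF : ∀ u v, F (u + v) = f u + f v) (h2 : ∀ m, F (m + m) = 2 * f m) :
    (∀ v ∈ S, f v ≤ 0) ∨
    (∃ p ∈ S, ∃ q ∈ S, (∀ v ∈ S, f v ≤ f p) ∧ 0 < f p ∧ 0 ≤ f q ∧ ¬ IsDouble (p + q)) ∨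
    (∃ p ∈ S, 0 < f p ∧ ∀ v ∈ S, v ≠ p → f v < 0) := by
  classical
  by_cases h : ∀ v ∈ S, f v ≤ 0
  · exact Or.inl h
  refine Or.inr ?_
  push Not at h
  obtain ⟨v₀, hv₀, hf₀⟩ := h
  obtain ⟨p, hp, hmax⟩ := S.exists_max_image f ⟨v₀, hv₀⟩
  have hp0 : 0 < f p := hf₀.trans_le (hmax _ hv₀)
  by_cases hq : ∃ q ∈ S, ¬ IsDouble (p + q) ∧ 0 ≤ f q
  · obtain ⟨q', hq', hpq', hfq'⟩ := hq
    exact Or.inl ⟨p, hp, q', hq', hmax, hp0, hfq', hpq'⟩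
  · push Not at hq
    refine Or.inr ⟨p, hp, hp0, ?_⟩
    by_contra hcon
    push Not at hcon
    obtain ⟨w, hw, hwp, hfw⟩ := hcon
    obtain ⟨v, hv, hvmin⟩ := (S.filter fun v => v ≠ p ∧ 0 ≤ f v).exists_min_image
      (fun v => ∑ i, (v i - p i).natAbs) ⟨w, by simp [hw, hwp, hfw]⟩
    rw [Finset.mem_filter] at hv
    obtain ⟨hvS, hvp, hfv⟩ := hv
    have hd : IsDouble (p + v) := by
      by_contra hd
      exact (hq v hvS hd).not_ge hfv
    obtain ⟨m, hm⟩ := hd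
    have hmS : m ∈ S := hS p hp v hvS m hm
    have hmf : 2 * f m = f p + f v := by rw [← h2, ← hm, hF]
    have hi : ∀ i, v i - p i = 2 * (m i - p i) := by
      intro i
      have := congrFun hm i
      simp only [Pi.add_apply] at this
      omega
    have hmp : m ≠ p := by
      rintro rfl
      apply hvp; ext i
      have := hi i; omega
    have hle := hvmin m (by simp [hmS, hmp]; linarith)
    have hsum : ∑ i, (v i - p i).natAbs = 2 * ∑ i, (m i - p i).natAbs := by
      rw [Finset.mul_sum]
      refine Finset.sum_congr rfl fun i _ => ?_
      rw [hi i, Int.natAbs_mul]; rfl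
    have hz : ∑ i, (m i - p i).natAbs = 0 := by omega
    apply hmp; ext i
    have := (Finset.sum_eq_zero_iff.1 hz) i (Finset.mem_univ i)
    omega

open Classical in
lemma HalvingClosed.pos_side_sum_le {S O : Finset (Fin d → ℤ)} (hS : HalvingClosed S)
    {f F : (Fin d → ℤ) → ℝ} (hF : ∀ u v, F (u + v) = f u + f v) (h2 : ∀ m, F (m + m) = 2 * f m)
    (hO : ∀ u ∈ S, ∀ v ∈ S, ¬ IsDouble (u + v) → u + v ∈ O) :
    (∃ p ∈ S, 0 < f p ∧ ∀ v ∈ S, v ≠ p → f v < 0) ∨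
      ∑ v ∈ S with 0 < f v, f v ^ 2 ≤ ∑ y ∈ O with 0 < F y, F y ^ 2 := by
  rcases hS.pos_side hF h2 with h | ⟨p, hp, q, hq, hmax, hp0, hq0, hpq⟩ | h
  · right
    rw [Finset.sum_eq_zero]
    · exact Finset.sum_nonneg fun y _ => sq_nonneg _
    · intro v hv
      rw [Finset.mem_filter] at hv
      exact absurd (h v hv.1) hv.2.not_ge
  · right
    have := sum_sq_pos_add_le hF hO hp hq hmax hp0 hq0 hpq
    have := mul_nonneg hp0.le hq0
    linarith
  · exact Or.inl h

lemma sum_sq_eq_pos_add_neg {ι : Type*} (S : Finset ι) (f : ι → ℝ) :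
    ∑ v ∈ S, f v ^ 2 = ∑ v ∈ S with 0 < f v, f v ^ 2 + ∑ v ∈ S with 0 < -f v, f v ^ 2 := by
  classical
  rw [Finset.sum_filter, Finset.sum_filter, ← Finset.sum_add_distrib]
  refine Finset.sum_congr rfl fun v _ => ?_
  rcases lt_trichotomy (f v) 0 with h | h | h
  · simp [h, h.not_gt]
  · simp [h]
  · simp [h, h.not_gt]

/-- The case of a single point at which `f` is positive. -/
lemma HalvingClosed.sum_sq_le_of_neg {S O : Finset (Fin d → ℤ)} (hS : HalvingClosed S)
    (hcard : 3 ≤ S.card)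
    {f F : (Fin d → ℤ) → ℝ} (hF : ∀ u v, F (u + v) = f u + f v) (h2 : ∀ m, F (m + m) = 2 * f m)
    (hO : ∀ u ∈ S, ∀ v ∈ S, ¬ IsDouble (u + v) → u + v ∈ O)
    {p : Fin d → ℤ} (hp : p ∈ S) (hp0 : 0 < f p) (hneg : ∀ v ∈ S, v ≠ p → f v < 0) :
    ∑ v ∈ S, f v ^ 2 ≤ ∑ y ∈ O, F y ^ 2 := by
  classical
  have hpos : ∑ v ∈ S with 0 < f v, f v ^ 2 = f p ^ 2 := by
    have : S.filter (fun v => 0 < f v) = {p} := by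
      ext v
      simp only [Finset.mem_filter, Finset.mem_singleton]
      refine ⟨fun h => ?_, fun h => h ▸ ⟨hp, hp0⟩⟩
      by_contra hv
      exact (hneg v h.1 hv).not_gt h.2
    rw [this, Finset.sum_singleton]
  have hF' : ∀ u v, (fun y => -F y) (u + v) = (fun y => -f y) u + (fun y => -f y) v := by
    intro u v; simp only [hF]; ring
  rcases hS.pos_side (f := fun y => -f y) (F := fun y => -F y) hF'
    (fun m => by simp only [h2]; ring) with h | ⟨q, hq, r, hr, hmax, hq0, hr0, hqr⟩ |
      ⟨q, hq, hq0, hpos'⟩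
  · exfalso
    obtain ⟨v, hv, hvp⟩ := Finset.exists_mem_ne (by omega : 1 < S.card) p
    have := h v hv; have := hneg v hv hvp; linarith
  · have key := sum_sq_pos_add_le (f := fun y => -f y) (F := fun y => -F y) hF' hO hq hr hmax hq0 hr0 hqr
    simp only [neg_sq] at key
    have hrp : r ≠ p := by rintro rfl; linarith
    have hqp : q ≠ p := by rintro rfl; linarith
    have hr1 := hneg r hr hrp
    have hqr' : f q ≤ f r := by have := hmax r hr; simpa using this
    rw [sum_sq_eq_pos_add_neg S f, sum_sq_eq_pos_add_neg O F, hpos]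
    set Ro := ∑ y ∈ O with 0 < F y, F y ^ 2 with hRo
    have hR0 : 0 ≤ Ro := Finset.sum_nonneg fun y _ => sq_nonneg _
    -- The negative side is already dominated with surplus `2 f q f r`; only the lone positive point
    -- `p` has to be paid for, by this surplus and the targets of positive value.
    suffices f p ^ 2 ≤ 2 * f q * f r + Ro by linarith
    -- The midpoint lies in `S` and differs from `p`, so it has negative value.
    have hmid : ∀ v ∈ S, v ≠ p → IsDouble (p + v) → f p + f v < 0 := by
      rintro v hv hvp ⟨m, hm⟩
      have hmp : m ≠ p := by rintro rfl; exact hvp (add_left_cancel hm)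
      have := hneg m (hS p hp v hv m hm) hmp
      have h3 := h2 m
      rw [← hm, hF] at h3; linarith
    have hone : ¬ IsDouble (p + r) → 0 < f p + f r → (f p + f r) ^ 2 ≤ Ro := by
      intro hd hlt
      rw [← hF]
      exact Finset.single_le_sum (f := fun y => F y ^ 2) (fun y _ => sq_nonneg _)
        (Finset.mem_filter.2 ⟨hO p hp r hr hd, by rwa [hF]⟩)
    by_cases hdr : IsDouble (p + r)
    · have := hmid r hr hrp hdr; nlinarith
    by_cases hle : f p + f r ≤ 0
    · nlinarith
    push Not at hle
    by_cases hle' : f p + f q ≤ 0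
    · have := hone hdr hle; nlinarith
    push Not at hle'
    have hdq : ¬ IsDouble (p + q) := fun h => by have := hmid q hq hqp h; linarith
    have hne : p + r ≠ p + q := by
      intro h
      have : r = q := add_left_cancel h
      exact hqr (this ▸ isDouble_add_self q)
    have htwo : (f p + f r) ^ 2 + (f p + f q) ^ 2 ≤ Ro := by
      rw [← hF, ← hF, ← Finset.sum_pair (f := fun y => F y ^ 2) hne]
      refine Finset.sum_le_sum_of_subset_of_nonneg ?_ fun y _ _ => sq_nonneg _
      intro y hy
      simp only [Finset.mem_insert, Finset.mem_singleton] at hy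
      rcases hy with rfl | rfl
      · exact Finset.mem_filter.2 ⟨hO p hp r hr hdr, by rwa [hF]⟩
      · exact Finset.mem_filter.2 ⟨hO p hp q hq hdq, by rwa [hF]⟩
    -- `(f p + f r)² + (f p + f q)² + 2 f q f r - f p²` is exactly the square of the sum of the
    -- three values.
    nlinarith [sq_nonneg (f p + f r + f q)]
  · exfalso
    have : S ⊆ {p, q} := by
      intro v hv
      simp only [Finset.mem_insert, Finset.mem_singleton]
      by_contra hcon
      push Not at hcon
      have h1 := hneg v hv hcon.1
      have h2 := hpos' v hv hcon.2
      linarith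
    have := Finset.card_le_card this
    have := Finset.card_le_two (a := p) (b := q)
    omega

/-- In a lattice-convex set with at least three points, the squares of the values of an affine
function at the points are dominated by its values at the sums of pairs that are not divisible
by two. -/
lemma HalvingClosed.sum_sq_le {S O : Finset (Fin d → ℤ)} (hS : HalvingClosed S)
    (hcard : 3 ≤ S.card)
    {f F : (Fin d → ℤ) → ℝ} (hF : ∀ u v, F (u + v) = f u + f v) (h2 : ∀ m, F (m + m) = 2 * f m)
    (hO : ∀ u ∈ S, ∀ v ∈ S, ¬ IsDouble (u + v) → u + v ∈ O) :
    ∑ v ∈ S, f v ^ 2 ≤ ∑ y ∈ O, F y ^ 2 := by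
  classical
  have hF' : ∀ u v, (fun y => -F y) (u + v) = (fun y => -f y) u + (fun y => -f y) v := by
    intro u v; simp only [hF]; ring
  have h2' : ∀ m, (fun y => -F y) (m + m) = 2 * (fun y => -f y) m := by
    intro m; simp only [h2]; ring
  have hpos : (∃ p ∈ S, 0 < f p ∧ ∀ v ∈ S, v ≠ p → f v < 0) ∨
      ∑ v ∈ S with 0 < f v, f v ^ 2 ≤ ∑ y ∈ O with 0 < F y, F y ^ 2 :=
    hS.pos_side_sum_le hF h2 hO
  have hneg : (∃ p ∈ S, 0 < -f p ∧ ∀ v ∈ S, v ≠ p → -f v < 0) ∨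
      ∑ v ∈ S with 0 < -f v, (-f v) ^ 2 ≤ ∑ y ∈ O with 0 < -F y, (-F y) ^ 2 :=
    hS.pos_side_sum_le (f := fun y => -f y) (F := fun y => -F y) hF' h2' hO
  rcases hpos with ⟨p, hp, hp0, hp'⟩ | hpos
  · exact hS.sum_sq_le_of_neg hcard hF h2 hO hp hp0 hp'
  rcases hneg with ⟨p, hp, hp0, hp'⟩ | hneg
  · have := hS.sum_sq_le_of_neg (f := fun y => -f y) (F := fun y => -F y) hcard hF' h2' hO hp
      hp0 hp'
    simpa only [neg_sq] using this
  · rw [sum_sq_eq_pos_add_neg S f, sum_sq_eq_pos_add_neg O F]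
    simp only [neg_sq] at hneg
    exact add_le_add hpos hneg

-- Doubling is injective and multiplies squares by four; the fifth copy comes from the points that
-- are not doubles.
open Classical in
lemma five_mul_sum_sq_le {S D : Finset (Fin d → ℤ)} {f F : (Fin d → ℤ) → ℝ}
    (h2 : ∀ m, F (m + m) = 2 * f m) (hSD : ∀ x ∈ S, x + x ∈ D)
    (h : ∑ v ∈ S, f v ^ 2 ≤ ∑ y ∈ D with ¬ IsDouble y, F y ^ 2) :
    5 * ∑ v ∈ S, f v ^ 2 ≤ ∑ y ∈ D, F y ^ 2 := by
  have hinj : ∀ x ∈ S, ∀ y ∈ S, x + x = y + y → x = y := by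
    intro x _ y _ hxy
    ext i
    have := congrFun hxy i
    simp only [Pi.add_apply] at this
    omega
  have hdbl : 4 * ∑ v ∈ S, f v ^ 2 ≤ ∑ y ∈ D with IsDouble y, F y ^ 2 := by
    have h4 : 4 * ∑ v ∈ S, f v ^ 2 = ∑ y ∈ S.image (fun x => x + x), F y ^ 2 := by
      rw [Finset.sum_image hinj, Finset.mul_sum]
      refine Finset.sum_congr rfl fun x _ => ?_
      rw [h2]; ring
    rw [h4]
    refine Finset.sum_le_sum_of_subset_of_nonneg ?_ fun y _ _ => sq_nonneg _
    intro y hy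
    obtain ⟨x, hx, rfl⟩ := Finset.mem_image.1 hy
    exact Finset.mem_filter.2 ⟨hSD x hx, isDouble_add_self x⟩
  rw [← Finset.sum_filter_add_sum_filter_not D IsDouble]
  linarith

/-- The analogue of `HalvingClosed.sum_sq_le` for the interior points of a larger set `W`,
where no lower bound on the number of points is needed. -/
lemma sum_sq_le_of_interior {S O W : Finset (Fin d → ℤ)}
    {f F : (Fin d → ℤ) → ℝ} (hF : ∀ u v, F (u + v) = f u + f v) (h2 : ∀ m, F (m + m) = 2 * f m)
    (hSW : S ⊆ W)
    (hSW2 : ∀ u ∈ S, ∀ v ∈ W, ∀ m, u + v = m + m → m ∈ S)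
    (hO : ∀ u ∈ S, ∀ v ∈ W, ¬ IsDouble (u + v) → u + v ∈ O)
    (hup : ∀ u ∈ S, ∃ w ∈ W, w ≠ u ∧ f u ≤ f w) (hdown : ∀ u ∈ S, ∃ w ∈ W, w ≠ u ∧ f w ≤ f u) :
    ∑ v ∈ S, f v ^ 2 ≤ ∑ y ∈ O, F y ^ 2 := by
  classical
  rcases Nat.lt_or_ge S.card 3 with hlt | hge
  swap
  · have hS : HalvingClosed S := fun u hu v hv => hSW2 u hu v (hSW hv)
    exact hS.sum_sq_le hge hF h2 fun u hu v hv => hO u hu v (hSW hv)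
  have single : ∀ y ∈ O, F y ^ 2 ≤ ∑ y ∈ O, F y ^ 2 := fun y hy =>
    Finset.single_le_sum (f := fun y => F y ^ 2) (fun y _ => sq_nonneg _) hy
  interval_cases hc : S.card
  · rw [Finset.card_eq_zero] at hc
    subst hc
    simpa using Finset.sum_nonneg fun y (_ : y ∈ O) => sq_nonneg (F y)
  · obtain ⟨v, rfl⟩ := Finset.card_eq_one.1 hc
    have hv := Finset.mem_singleton_self v
    rw [Finset.sum_singleton]
    -- The midpoint of `v` and another point of `W` would be a second point of `S`.
    have hodd : ∀ w ∈ W, w ≠ v → v + w ∈ O := by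
      intro w hw hwv
      refine hO v hv w hw ?_
      rintro ⟨m, hm⟩
      have := hSW2 v hv w hw m hm
      rw [Finset.mem_singleton] at this
      subst this
      exact hwv (add_left_cancel hm)
    rcases le_total 0 (f v) with h | h
    · obtain ⟨w, hw, hwv, hfw⟩ := hup v hv
      refine le_trans ?_ (single _ (hodd w hw hwv))
      rw [hF]; nlinarith
    · obtain ⟨w, hw, hwv, hfw⟩ := hdown v hv
      refine le_trans ?_ (single _ (hodd w hw hwv))
      rw [hF]; nlinarith
  · obtain ⟨u, v, huv, rfl⟩ := Finset.card_eq_two.1 hc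
    have hu : u ∈ ({u, v} : Finset (Fin d → ℤ)) := by simp
    have hv : v ∈ ({u, v} : Finset (Fin d → ℤ)) := by simp
    rw [Finset.sum_pair huv]
    have huvO : u + v ∈ O := by
      refine hO u hu v (hSW hv) ?_
      rintro ⟨m, hm⟩
      have := hSW2 u hu v (hSW hv) m hm
      simp only [Finset.mem_insert, Finset.mem_singleton] at this
      rcases this with rfl | rfl
      · exact huv (add_left_cancel hm).symm
      · exact huv (add_right_cancel hm)
    -- Opposite signs, with the positive value the larger in absolute value: a point `w` with `f w ≥
    -- f u'` gives `F (u' + w) ≥ 2 f u'`, whose square already dominates. The other sign patterns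
    -- reduce to this one by swapping the points or negating `f`.
    have main : ∀ f F : (Fin d → ℤ) → ℝ, (∀ u v, F (u + v) = f u + f v) →
        (∀ m, F (m + m) = 2 * f m) →
        (∀ x ∈ ({u, v} : Finset (Fin d → ℤ)), ∃ w ∈ W, w ≠ x ∧ f x ≤ f w) →
        ∀ u' ∈ ({u, v} : Finset (Fin d → ℤ)), ∀ v' : Fin d → ℤ,
          (∀ x ∈ ({u, v} : Finset (Fin d → ℤ)), x = u' ∨ x = v') → u' + v' = u + v →
          0 < f u' → f v' < 0 → -f v' ≤ f u' → f u' ^ 2 + f v' ^ 2 ≤ ∑ y ∈ O, F y ^ 2 := by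
      intro f F hF h2 hup a ha b hab hsum ha0 hb0 hle
      obtain ⟨w, hw, hwa, hfw⟩ := hup a ha
      have hO1 : a + w ∈ O := by
        refine hO a ha w hw ?_
        rintro ⟨m, hm⟩
        have hmf := h2 m
        rw [← hm, hF] at hmf
        rcases hab m (hSW2 a ha w hw m hm) with rfl | rfl
        · exact hwa (add_left_cancel hm)
        · linarith
      have hO2 : a + b ∈ O := hsum ▸ huvO
      have hne : a + w ≠ a + b := by
        intro h
        have : w = b := add_left_cancel h
        subst this; linarith
      have hle2 : F (a + w) ^ 2 + F (a + b) ^ 2 ≤ ∑ y ∈ O, F y ^ 2 := by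
        rw [← Finset.sum_pair (f := fun y => F y ^ 2) hne]
        refine Finset.sum_le_sum_of_subset_of_nonneg ?_ fun y _ _ => sq_nonneg _
        intro y hy
        simp only [Finset.mem_insert, Finset.mem_singleton] at hy
        rcases hy with rfl | rfl <;> assumption
      rw [hF, hF] at hle2
      nlinarith
    by_cases hprod : 0 ≤ f u * f v
    · have := single _ huvO
      rw [hF] at this
      nlinarith
    push Not at hprod
    have hF' : ∀ u v, (fun y => -F y) (u + v) = (fun y => -f y) u + (fun y => -f y) v := by
      intro u v; simp only [hF]; ring
    have h2' : ∀ m, (fun y => -F y) (m + m) = 2 * (fun y => -f y) m := by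
      intro m; simp only [h2]; ring
    have hup' : ∀ x ∈ ({u, v} : Finset (Fin d → ℤ)), ∃ w ∈ W, w ≠ x ∧ -f x ≤ -f w := by
      intro x hx
      obtain ⟨w, hw, hwu, hfw⟩ := hdown x hx
      exact ⟨w, hw, hwu, by linarith⟩
    have m1 := main f F hF h2 hup
    have m2 := main (fun y => -f y) (fun y => -F y) hF' h2' hup'
    simp only [neg_sq] at m2
    have ex : ∀ x ∈ ({u, v} : Finset (Fin d → ℤ)), x = u ∨ x = v := by simp
    have ex' : ∀ x ∈ ({u, v} : Finset (Fin d → ℤ)), x = v ∨ x = u := by simp [or_comm]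
    rcases mul_neg_iff.1 hprod with ⟨h1, h3⟩ | ⟨h1, h3⟩
    · rcases le_total (-f v) (f u) with h | h
      · exact m1 u hu v ex rfl h1 h3 h
      · rw [add_comm]
        exact m2 v hv u ex' (add_comm v u) (by linarith) (by linarith) (by linarith)
    · rcases le_total (-f u) (f v) with h | h
      · rw [add_comm]
        exact m1 v hv u ex' (add_comm v u) h3 h1 h
      · exact m2 u hu v ex rfl (by linarith) (by linarith) (by linarith)

end Plane

/-! ### Quartic functions -/

/-- Real polynomial functions of degree at most four. -/
def IsQuartic (f : ℝ → ℝ) : Prop := ∃ c : Fin 5 → ℝ, ∀ x, f x = ∑ i, c i * x ^ (i : ℕ)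

lemma IsQuartic.add {f g : ℝ → ℝ} (hf : IsQuartic f) (hg : IsQuartic g) :
    IsQuartic fun x => f x + g x := by
  obtain ⟨c, hc⟩ := hf
  obtain ⟨e, he⟩ := hg
  exact ⟨c + e, fun x => by
    simp only [hc, he, ← Finset.sum_add_distrib, Pi.add_apply, add_mul]⟩

lemma IsQuartic.neg {f : ℝ → ℝ} (hf : IsQuartic f) : IsQuartic fun x => -f x := by
  obtain ⟨c, hc⟩ := hf
  exact ⟨-c, fun x => by simp only [hc, Pi.neg_apply, neg_mul, Finset.sum_neg_distrib]⟩

lemma IsQuartic.sum {ι : Type*} {f : ι → ℝ → ℝ} {s : Finset ι} (hf : ∀ i ∈ s, IsQuartic (f i)) :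
    IsQuartic fun x => ∑ i ∈ s, f i x := by
  classical
  induction s using Finset.induction_on with
  | empty => exact ⟨0, by simp⟩
  | insert i s hi ih =>
    simp only [Finset.sum_insert hi]
    exact (hf i (by simp)).add (ih fun j hj => hf j (by simp [hj]))

lemma IsQuartic.comp_sub {f : ℝ → ℝ} (hf : IsQuartic f) (a : ℝ) :
    IsQuartic fun x => f (x - a) := by
  obtain ⟨c, hc⟩ := hf
  refine ⟨![c 0 - c 1 * a + c 2 * a ^ 2 - c 3 * a ^ 3 + c 4 * a ^ 4,
    c 1 - 2 * c 2 * a + 3 * c 3 * a ^ 2 - 4 * c 4 * a ^ 3,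
    c 2 - 3 * c 3 * a + 6 * c 4 * a ^ 2, c 3 - 4 * c 4 * a, c 4], fun x => ?_⟩
  simp only [hc, Fin.sum_univ_five]
  simp
  ring

/-! ### Closed formulas for sums over simplices of exponents -/

section SimplexSums

variable {I : Type*} [DecidableEq I]

/-- The sum of `(β + ∑ kᵢ aᵢ)²` over the exponents `k` of degree `m` supported in `s`. -/
noncomputable def simplexSum (a : I → ℝ) (s : Finset I) (β : ℝ) (m : ℕ) : ℝ :=
  ∑ k ∈ Finset.piAntidiag s m, (β + ∑ i ∈ s, (k i : ℝ) * a i) ^ 2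

lemma simplexSum_cons (a : I → ℝ) {s : Finset I} {i : I} (hi : i ∉ s) (β : ℝ) (m : ℕ) :
    simplexSum a (Finset.cons i s hi) β m =
      ∑ p ∈ Finset.HasAntidiagonal.antidiagonal m, simplexSum a s (β + p.1 * a i) p.2 := by
  unfold simplexSum
  rw [Finset.piAntidiag_cons, Finset.sum_disjiUnion]
  refine Finset.sum_congr rfl fun p _ => ?_
  rw [Finset.sum_map]
  refine Finset.sum_congr rfl fun k hk => ?_
  have hki : k i = 0 := by
    by_contra h
    exact hi ((Finset.mem_piAntidiag.1 hk).2 i h)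
  rw [Finset.sum_cons]
  have : ∑ x ∈ s, (((addRightEmbedding fun t => if t = i then p.1 else 0) k) x : ℝ) * a x =
      ∑ x ∈ s, (k x : ℝ) * a x := by
    refine Finset.sum_congr rfl fun x hx => ?_
    have hxi : x ≠ i := by rintro rfl; exact hi hx
    simp [hxi]
  rw [this]
  simp [hki]
  ring

/-- Splitting off the terms where the exponent of `i` is zero gives a recursion in the degree; in
the others one copy of `a i` is absorbed into `β`. A proposed closed formula therefore needs only
two checks. -/
lemma simplexSum_cons_eq (a : I → ℝ) {s : Finset I} {i : I} (hi : i ∉ s) {q q' : ℝ → ℕ → ℝ}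
    (hq : ∀ β m, simplexSum a s β m = q β m) (h0 : ∀ β, q' β 0 = q β 0)
    (hs : ∀ β m, q' β (m + 1) = q β (m + 1) + q' (β + a i) m) (β : ℝ) (m : ℕ) :
    simplexSum a (Finset.cons i s hi) β m = q' β m := by
  induction m generalizing β with
  | zero => rw [simplexSum_cons, h0, ← hq]; simp
  | succ m ih =>
    rw [hs, ← ih, simplexSum_cons, simplexSum_cons, Finset.Nat.sum_antidiagonal_succ, hq]
    simp only [Nat.cast_zero, zero_mul, add_zero]
    congr 1
    refine Finset.sum_congr rfl fun p _ => ?_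
    congr 1
    push_cast; ring

lemma simplexSum_singleton (a : I → ℝ) (i : I) (β : ℝ) (m : ℕ) :
    simplexSum a {i} β m = (β + m * a i) ^ 2 := by
  have : ({i} : Finset I) = Finset.cons i ∅ (Finset.notMem_empty i) := by simp
  rw [this]
  refine simplexSum_cons_eq a _ (q := fun β m => if m = 0 then β ^ 2 else 0)
    (q' := fun β m => (β + m * a i) ^ 2) ?_ ?_ ?_ β m
  · intro β m
    rcases m with _ | m
    · simp [simplexSum]
    · simp [simplexSum]
  · intro β; simp
  · intro β m; simp; ring

lemma simplexSum_pair (a : I → ℝ) {i j : I} (hij : i ∉ ({j} : Finset I)) (β : ℝ) (m : ℕ) :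
    simplexSum a (Finset.cons i {j} hij) β m = β ^ 2 * (m + 1) +
      (2 * β * (a i + a j) + (a i ^ 2 + a j ^ 2)) * ((m + 1) * m / 2) +
      ((a i + a j) ^ 2 + (a i ^ 2 + a j ^ 2)) * ((m + 1) * m * (m - 1) / 6) := by
  refine simplexSum_cons_eq a hij (q' := fun β m => β ^ 2 * (m + 1) +
      (2 * β * (a i + a j) + (a i ^ 2 + a j ^ 2)) * ((m + 1) * m / 2) +
      ((a i + a j) ^ 2 + (a i ^ 2 + a j ^ 2)) * ((m + 1) * m * (m - 1) / 6))
    (simplexSum_singleton a j) ?_ ?_ β m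
  · intro β; simp
  · intro β m; push_cast; ring

lemma simplexSum_triple (a : I → ℝ) {i j l : I} (hjl : j ∉ ({l} : Finset I))
    (hi : i ∉ Finset.cons j {l} hjl) (β : ℝ) (m : ℕ) :
    simplexSum a (Finset.cons i (Finset.cons j {l} hjl) hi) β m =
      β ^ 2 * ((m + 2) * (m + 1) / 2) +
      (2 * β * (a i + a j + a l) + (a i ^ 2 + a j ^ 2 + a l ^ 2)) *
        ((m + 2) * (m + 1) * m / 6) +
      ((a i + a j + a l) ^ 2 + (a i ^ 2 + a j ^ 2 + a l ^ 2)) *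
        ((m + 2) * (m + 1) * m * (m - 1) / 24) := by
  refine simplexSum_cons_eq a hi (q' := fun β m => β ^ 2 * ((m + 2) * (m + 1) / 2) +
      (2 * β * (a i + a j + a l) + (a i ^ 2 + a j ^ 2 + a l ^ 2)) *
        ((m + 2) * (m + 1) * m / 6) +
      ((a i + a j + a l) ^ 2 + (a i ^ 2 + a j ^ 2 + a l ^ 2)) *
        ((m + 2) * (m + 1) * m * (m - 1) / 24)) (simplexSum_pair a hjl) ?_ ?_ β m
  · intro β; simp
  · intro β m; push_cast; ring

end SimplexSums

/-! ### Simplicial cones: polynomiality and reciprocity -/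

section Cone

variable {G I : Type*} [AddCommGroup G] [Fintype I] [DecidableEq I]

/-- The squares of an additive function summed over the points of given height in a set that is
freely generated by the vectors `Vᵢ` over a finite set of representatives. -/
lemma finsum_sq_eq_sum_simplexSum {V : I → G} {ht : G →+ ℤ} {w : G →+ ℝ} (hV : ∀ i, ht (V i) = 1)
    {T : Finset G} {C : Set G}
    (hC : Set.BijOn (fun p : G × (I → ℕ) => p.1 + ∑ i, p.2 i • V i)
      ((T : Set G) ×ˢ Set.univ) C) (n : ℤ) :
    ∑ᶠ y ∈ {y | y ∈ C ∧ ht y = n}, w y ^ 2 =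
      ∑ b ∈ T, if ht b ≤ n then
        simplexSum (fun i => w (V i)) Finset.univ (w b) (n - ht b).toNat else 0 := by
  classical
  -- The guard on the height is needed because `toNat` would turn a negative degree into zero.
  set R : Finset (Σ _ : G, I → ℕ) := T.sigma fun b =>
    if ht b ≤ n then Finset.piAntidiag Finset.univ (n - ht b).toNat else ∅ with hR
  have hht : ∀ (b : G) (k : I → ℕ), ht (b + ∑ i, k i • V i) = ht b + (∑ i, k i : ℕ) := by
    intro b k
    simp [map_sum, hV]
  have hmem : ∀ (b : G) (k : I → ℕ), (⟨b, k⟩ : Σ _ : G, I → ℕ) ∈ R ↔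
      b ∈ T ∧ ht b + (∑ i, k i : ℕ) = n := by
    intro b k
    simp only [hR, Finset.mem_sigma]
    refine and_congr_right fun _ => ?_
    split_ifs with h
    · simp only [Finset.mem_piAntidiag, Finset.mem_univ, implies_true, and_true]
      obtain ⟨s, hs⟩ : ∃ s, s = ∑ i, k i := ⟨_, rfl⟩
      rw [← hs]
      omega
    · simp only [Finset.notMem_empty, false_iff]
      intro h'
      omega
  have hbij : Set.BijOn (fun p : Σ _ : G, I → ℕ => p.1 + ∑ i, p.2 i • V i) (R : Set _)
      {y | y ∈ C ∧ ht y = n} := by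
    refine ⟨?_, ?_, ?_⟩
    · rintro ⟨b, k⟩ hp
      obtain ⟨hb, hk⟩ := (hmem b k).1 hp
      exact ⟨hC.mapsTo (x := (b, k)) ⟨hb, trivial⟩, by rw [hht, hk]⟩
    · rintro ⟨b, k⟩ hp ⟨b', k'⟩ hp' h
      have := hC.injOn (x₁ := (b, k)) (x₂ := (b', k')) ⟨((hmem b k).1 hp).1, trivial⟩
        ⟨((hmem b' k').1 hp').1, trivial⟩ h
      simp only [Prod.mk.injEq] at this
      obtain ⟨rfl, rfl⟩ := this
      rfl
    · rintro y ⟨hy, hyn⟩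
      obtain ⟨⟨b, k⟩, ⟨hb, -⟩, rfl⟩ := hC.surjOn hy
      exact ⟨⟨b, k⟩, (hmem b k).2 ⟨hb, by rw [← hht]; exact hyn⟩, rfl⟩
  rw [← finsum_mem_eq_of_bijOn _ hbij (fun x _ => rfl), finsum_mem_coe_finset, hR,
    Finset.sum_sigma]
  refine Finset.sum_congr rfl fun b _ => ?_
  split_ifs with h
  · unfold simplexSum
    refine Finset.sum_congr rfl fun k _ => ?_
    simp [map_sum]
  · simp

variable {V : I → G} {c : I → G →+ ℝ}

lemma coord_add_sum (hcV : ∀ i j, c i (V j) = if i = j then 1 else 0) (b : G) (k : I → ℕ) (i : I) :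
    c i (b + ∑ j, k j • V j) = c i b + k i := by
  simp [map_sum, hcV]

/-- Integer parts of the coordinates are split off, leaving a unique representative in the box `[0,
1)^I`. -/
lemma bijOn_closedCone (hcV : ∀ i j, c i (V j) = if i = j then 1 else 0) {B : Finset G}
    (hB : ∀ y, y ∈ B ↔ ∀ i, 0 ≤ c i y ∧ c i y < 1) :
    Set.BijOn (fun p : G × (I → ℕ) => p.1 + ∑ i, p.2 i • V i)
      ((B : Set G) ×ˢ Set.univ) {y | ∀ i, 0 ≤ c i y} := by
  refine ⟨?_, ?_, ?_⟩
  · rintro ⟨b, k⟩ ⟨hb, -⟩ i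
    have := (hB b).1 hb i
    simp only [coord_add_sum hcV]
    have : (0 : ℝ) ≤ k i := Nat.cast_nonneg _
    linarith
  · rintro ⟨b, k⟩ ⟨hb, -⟩ ⟨b', k'⟩ ⟨hb', -⟩ h
    simp only at h
    have hk : k = k' := by
      ext i
      have h1 := (hB b).1 hb i
      have h2 := (hB b').1 hb' i
      have h3 := congrArg (c i) h
      rw [coord_add_sum hcV, coord_add_sum hcV] at h3
      have h4 : (k i : ℝ) < k' i + 1 := by linarith
      have h5 : (k' i : ℝ) < k i + 1 := by linarith
      have h4' : k i < k' i + 1 := by exact_mod_cast h4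
      have h5' : k' i < k i + 1 := by exact_mod_cast h5
      omega
    subst hk
    rw [add_right_cancel h]
  · intro y hy
    refine ⟨(y - ∑ i, (⌊c i y⌋₊) • V i, fun i => ⌊c i y⌋₊), ⟨?_, trivial⟩, by simp⟩
    refine (hB _).2 fun i => ?_
    have : c i (y - ∑ i, (⌊c i y⌋₊) • V i) = c i y - ⌊c i y⌋₊ := by
      have := coord_add_sum hcV (y - ∑ i, (⌊c i y⌋₊) • V i) (fun i => ⌊c i y⌋₊) i
      rw [sub_add_cancel] at this
      linarith
    rw [this]
    have := Nat.floor_le (hy i)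
    have := Nat.lt_floor_add_one (c i y)
    constructor <;> linarith

-- For the open cone the box is `(0, 1]^I`, the reflection of `[0, 1)^I` in the point `∑ V i / 2`.
-- This reflection is the source of reciprocity.
open Classical in
lemma bijOn_openCone (hcV : ∀ i j, c i (V j) = if i = j then 1 else 0) {B : Finset G}
    (hB : ∀ y, y ∈ B ↔ ∀ i, 0 ≤ c i y ∧ c i y < 1) :
    Set.BijOn (fun p : G × (I → ℕ) => p.1 + ∑ i, p.2 i • V i)
      ((B.image fun b => ∑ i, V i - b : Finset G) ×ˢ Set.univ) {y | ∀ i, 0 < c i y} := by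
  have hsum : ∀ i, c i (∑ j, V j) = 1 := by intro i; simp [map_sum, hcV]
  have hB' : ∀ y, y ∈ (B.image fun b => ∑ i, V i - b) ↔ ∀ i, 0 < c i y ∧ c i y ≤ 1 := by
    intro y
    have h1 : y ∈ (B.image fun b => ∑ i, V i - b) ↔ ∑ i, V i - y ∈ B := by
      rw [Finset.mem_image]
      constructor
      · rintro ⟨b, hb, rfl⟩; simpa using hb
      · intro h; exact ⟨_, h, by simp⟩
    rw [h1, hB]
    refine forall_congr' fun i => ?_
    rw [map_sub, hsum]
    constructor <;> rintro ⟨h1, h2⟩ <;> constructor <;> linarith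
  refine ⟨?_, ?_, ?_⟩
  · rintro ⟨b, k⟩ ⟨hb, -⟩ i
    have := (hB' b).1 hb i
    simp only [coord_add_sum hcV]
    have : (0 : ℝ) ≤ k i := Nat.cast_nonneg _
    linarith
  · rintro ⟨b, k⟩ ⟨hb, -⟩ ⟨b', k'⟩ ⟨hb', -⟩ h
    simp only at h
    have hk : k = k' := by
      ext i
      have h1 := (hB' b).1 hb i
      have h2 := (hB' b').1 hb' i
      have h3 := congrArg (c i) h
      rw [coord_add_sum hcV, coord_add_sum hcV] at h3
      have h4 : (k i : ℝ) < k' i + 1 := by linarith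
      have h5 : (k' i : ℝ) < k i + 1 := by linarith
      have h4' : k i < k' i + 1 := by exact_mod_cast h4
      have h5' : k' i < k i + 1 := by exact_mod_cast h5
      omega
    subst hk
    rw [add_right_cancel h]
  · intro y hy
    -- Using the ceiling minus one leaves remainders in `(0, 1]`, not in `[0, 1)`.
    refine ⟨(y - ∑ i, (⌈c i y⌉₊ - 1) • V i, fun i => ⌈c i y⌉₊ - 1), ⟨?_, trivial⟩, by simp⟩
    refine (hB' _).2 fun i => ?_
    have hy := hy i
    have : c i (y - ∑ i, (⌈c i y⌉₊ - 1) • V i) = c i y - (⌈c i y⌉₊ - 1 : ℕ) := by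
      have := coord_add_sum hcV (y - ∑ i, (⌈c i y⌉₊ - 1) • V i) (fun i => ⌈c i y⌉₊ - 1) i
      rw [sub_add_cancel] at this
      linarith
    rw [this, Nat.cast_pred (Nat.ceil_pos.2 hy)]
    have := Nat.le_ceil (c i y)
    have := Nat.ceil_lt_add_one hy.le
    constructor <;> linarith

/-- Weighted Ehrhart polynomial and reciprocity for a simplicial cone, given a closed formula `q`
for the sums over the exponents of degree `m`. -/
lemma exists_quartic_of_cone [Nonempty I] {ht : G →+ ℤ} {w : G →+ ℝ}
    (hcV : ∀ i j, c i (V j) = if i = j then 1 else 0)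
    (hB : {y | ∀ i, 0 ≤ c i y ∧ c i y < 1}.Finite)
    (hht : ∀ y, (ht y : ℝ) = ∑ i, c i y) (hker : ∀ y, (∀ i, c i y = 0) → w y = 0)
    {q : ℝ → ℝ → ℝ} {ε : ℝ}
    (hq : ∀ β (m : ℕ), simplexSum (fun i => w (V i)) Finset.univ β m = q β m)
    (hquart : ∀ β, IsQuartic (q β))
    (hvan : ∀ β (j : ℕ), 1 ≤ j → j < Fintype.card I → q β (-j) = 0)
    (hrefl : ∀ β m, q (∑ i, w (V i) - β) (m - Fintype.card I) = ε * q β (-m)) :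
    ∃ f, IsQuartic f ∧ f 0 = 0 ∧ ∀ n : ℕ, 1 ≤ n →
      ∑ᶠ y ∈ {y | (∀ i, 0 ≤ c i y) ∧ ht y = n}, w y ^ 2 = f n ∧
      ∑ᶠ y ∈ {y | (∀ i, 0 < c i y) ∧ ht y = n}, w y ^ 2 = ε * f (-n) := by
  classical
  have hBm : ∀ y, y ∈ hB.toFinset ↔ ∀ i, 0 ≤ c i y ∧ c i y < 1 := by simp
  set B := hB.toFinset
  have hV : ∀ i, ht (V i) = 1 := by
    intro i
    have := hht (V i)
    simp only [hcV, Finset.sum_ite_eq', Finset.mem_univ, if_true] at this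
    exact_mod_cast this
  have hbox : ∀ b ∈ B, 0 ≤ ht b ∧ ht b < Fintype.card I := by
    intro b hb
    have hb := (hBm b).1 hb
    have h0 : (0 : ℝ) ≤ ht b := by
      rw [hht]; exact Finset.sum_nonneg fun i _ => (hb i).1
    have h1 : (ht b : ℝ) < Fintype.card I := by
      rw [hht]
      calc ∑ i, c i b < ∑ _i : I, (1 : ℝ) :=
            Finset.sum_lt_sum_of_nonempty Finset.univ_nonempty fun i _ => (hb i).2
        _ = Fintype.card I := by simp
    exact ⟨by exact_mod_cast h0, by exact_mod_cast h1⟩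
  have hclosed : ∀ n : ℕ, ∑ᶠ y ∈ {y | (∀ i, 0 ≤ c i y) ∧ ht y = n}, w y ^ 2 =
      ∑ b ∈ B, q (w b) ((n : ℝ) - ht b) := by
    intro n
    have := finsum_sq_eq_sum_simplexSum (w := w) hV (bijOn_closedCone hcV hBm) n
    simp only [Set.mem_ofPred_eq] at this ⊢
    rw [this]
    refine Finset.sum_congr rfl fun b hb => ?_
    obtain ⟨h0, h1⟩ := hbox b hb
    split_ifs with h
    · rw [hq]
      congr 1
      have : (((n : ℤ) - ht b).toNat : ℤ) = n - ht b := Int.toNat_of_nonneg (by omega)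
      exact_mod_cast congrArg (Int.cast : ℤ → ℝ) this
    -- A box point higher than `n` contributes nothing; the formula agrees, since `q` vanishes at
    -- the negative integers above `-card I`.
    · have h2 : ((ht b - n).toNat : ℤ) = ht b - n := Int.toNat_of_nonneg (by omega)
      have h3 : ((ht b - n).toNat : ℝ) = ht b - n := by
        exact_mod_cast congrArg (Int.cast : ℤ → ℝ) h2
      rw [← hvan (w b) (ht b - n).toNat (by omega) (by omega), h3]
      congr 1; ring
  refine ⟨fun x => ∑ b ∈ B, q (w b) (x - ht b),
    IsQuartic.sum fun b _ => (hquart (w b)).comp_sub _, ?_, fun n hn => ⟨hclosed n, ?_⟩⟩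
  -- At height zero all coordinates vanish, hence so does the weight.
  · have h := hclosed 0
    simp only [Nat.cast_zero] at h
    refine h.symm.trans ?_
    refine finsum_mem_eq_zero_of_forall_eq_zero fun y hy => ?_
    obtain ⟨hy, hy0⟩ := hy
    have hs := hht y
    rw [hy0, Int.cast_zero] at hs
    have := (Finset.sum_eq_zero_iff_of_nonneg fun i _ => hy i).1 hs.symm
    rw [hker y fun i => this i (Finset.mem_univ i)]
    simp
  · have := finsum_sq_eq_sum_simplexSum (w := w) hV (bijOn_openCone hcV hBm) n
    simp only [Set.mem_ofPred_eq] at this ⊢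
    rw [this, Finset.sum_image (by intro x _ y _ h; simpa using h), Finset.mul_sum]
    refine Finset.sum_congr rfl fun b hb => ?_
    obtain ⟨h0, h1⟩ := hbox b hb
    have e1 : ht (∑ i, V i - b) = Fintype.card I - ht b := by simp [map_sum, hV]
    have e2 : ε * q (w b) (-(n : ℝ) - ht b) =
        q (w (∑ i, V i - b)) ((n : ℝ) - ht (∑ i, V i - b)) := by
      have := hrefl (w b) (n + ht b)
      rw [e1, map_sub, map_sum, show (-(n : ℝ) - ht b) = -(n + ht b) by ring, ← this]
      congr 1
      push_cast; ring
    rw [e2]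
    set z := ∑ i, V i - b
    split_ifs with h
    · rw [hq]
      congr 1
      have : (((n : ℤ) - ht z).toNat : ℤ) = n - ht z := Int.toNat_of_nonneg (by omega)
      exact_mod_cast congrArg (Int.cast : ℤ → ℝ) this
    · have h2 : ((ht z - n).toNat : ℤ) = ht z - n := Int.toNat_of_nonneg (by omega)
      have h3 : ((ht z - n).toNat : ℝ) = ht z - n := by
        exact_mod_cast congrArg (Int.cast : ℤ → ℝ) h2
      rw [← hvan (w z) (ht z - n).toNat (by omega) (by omega), h3]
      congr 1; ring

lemma exists_quartic_of_cone_fin_three {V : Fin 3 → G} {c : Fin 3 → G →+ ℝ}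
    {ht : G →+ ℤ} {w : G →+ ℝ}
    (hcV : ∀ i j, c i (V j) = if i = j then 1 else 0)
    (hB : {y | ∀ i, 0 ≤ c i y ∧ c i y < 1}.Finite)
    (hht : ∀ y, (ht y : ℝ) = ∑ i, c i y) (hker : ∀ y, (∀ i, c i y = 0) → w y = 0) :
    ∃ f, IsQuartic f ∧ f 0 = 0 ∧ ∀ n : ℕ, 1 ≤ n →
      ∑ᶠ y ∈ {y | (∀ i, 0 ≤ c i y) ∧ ht y = n}, w y ^ 2 = f n ∧
      ∑ᶠ y ∈ {y | (∀ i, 0 < c i y) ∧ ht y = n}, w y ^ 2 = f (-n) := by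
  set a : Fin 3 → ℝ := fun i => w (V i) with ha
  have hu : (Finset.univ : Finset (Fin 3)) =
      Finset.cons 0 (Finset.cons 1 {2} (by simp)) (by decide) := by decide
  have := exists_quartic_of_cone (w := w) hcV hB hht hker (ε := 1)
    (q := fun β m => β ^ 2 * ((m + 2) * (m + 1) / 2) +
      (2 * β * (a 0 + a 1 + a 2) + (a 0 ^ 2 + a 1 ^ 2 + a 2 ^ 2)) *
        ((m + 2) * (m + 1) * m / 6) +
      ((a 0 + a 1 + a 2) ^ 2 + (a 0 ^ 2 + a 1 ^ 2 + a 2 ^ 2)) *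
        ((m + 2) * (m + 1) * m * (m - 1) / 24))
    (fun β m => by rw [hu]; exact simplexSum_triple a _ _ β m) ?_ ?_ ?_
  · simpa only [one_mul] using this
  · intro β
    set A := a 0 + a 1 + a 2
    set Q := a 0 ^ 2 + a 1 ^ 2 + a 2 ^ 2
    refine ⟨![β ^ 2, 3 / 2 * β ^ 2 + (2 * β * A + Q) / 3 - (A ^ 2 + Q) / 12,
      β ^ 2 / 2 + (2 * β * A + Q) / 2 - (A ^ 2 + Q) / 24,
      (2 * β * A + Q) / 6 + (A ^ 2 + Q) / 12, (A ^ 2 + Q) / 24], fun x => ?_⟩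
    simp [Fin.sum_univ_five]
    ring
  · intro β j h1 h2
    simp only [Fintype.card_fin] at h2
    interval_cases j <;> norm_num
  · intro β m
    simp only [Fintype.card_fin, Fin.sum_univ_three, ha]
    push_cast
    ring

lemma exists_quartic_of_cone_fin_two {V : Fin 2 → G} {c : Fin 2 → G →+ ℝ}
    {ht : G →+ ℤ} {w : G →+ ℝ}
    (hcV : ∀ i j, c i (V j) = if i = j then 1 else 0)
    (hB : {y | ∀ i, 0 ≤ c i y ∧ c i y < 1}.Finite)
    (hht : ∀ y, (ht y : ℝ) = ∑ i, c i y) (hker : ∀ y, (∀ i, c i y = 0) → w y = 0) :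
    ∃ f, IsQuartic f ∧ f 0 = 0 ∧ ∀ n : ℕ, 1 ≤ n →
      ∑ᶠ y ∈ {y | (∀ i, 0 ≤ c i y) ∧ ht y = n}, w y ^ 2 = f n ∧
      ∑ᶠ y ∈ {y | (∀ i, 0 < c i y) ∧ ht y = n}, w y ^ 2 = -f (-n) := by
  set a : Fin 2 → ℝ := fun i => w (V i) with ha
  have hu : (Finset.univ : Finset (Fin 2)) = Finset.cons 0 {1} (by simp) := by decide
  have := exists_quartic_of_cone (w := w) hcV hB hht hker (ε := -1)
    (q := fun β m => β ^ 2 * (m + 1) +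
      (2 * β * (a 0 + a 1) + (a 0 ^ 2 + a 1 ^ 2)) * ((m + 1) * m / 2) +
      ((a 0 + a 1) ^ 2 + (a 0 ^ 2 + a 1 ^ 2)) * ((m + 1) * m * (m - 1) / 6))
    (fun β m => by rw [hu]; exact simplexSum_pair a _ β m) ?_ ?_ ?_
  · simpa only [neg_one_mul] using this
  · intro β
    set A := a 0 + a 1
    set Q := a 0 ^ 2 + a 1 ^ 2
    refine ⟨![β ^ 2, β ^ 2 + (2 * β * A + Q) / 2 - (A ^ 2 + Q) / 6,
      (2 * β * A + Q) / 2, (A ^ 2 + Q) / 6, 0], fun x => ?_⟩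
    simp [Fin.sum_univ_five]
    ring
  · intro β j h1 h2
    simp only [Fintype.card_fin] at h2
    interval_cases j; norm_num
  · intro β m
    simp only [Fintype.card_fin, Fin.sum_univ_two, ha]
    push_cast
    ring

end Cone

lemma latticePoint_add {d : ℕ} (x y : Fin d → ℤ) :
    latticePoint (x + y) = latticePoint x + latticePoint y := by
  ext i; simp [latticePoint]

lemma finite_latticePoint_preimage {d : ℕ} {A : Set (Fin d → ℝ)} (hA : Bornology.IsBounded A) :
    {x : Fin d → ℤ | latticePoint x ∈ A}.Finite := by
  obtain ⟨R, hR⟩ := hA.subset_closedBall 0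
  refine (Set.finite_Icc (fun _ : Fin d => -⌈R⌉) (fun _ => ⌈R⌉)).subset fun x hx => ?_
  have h1 : ‖latticePoint x‖ ≤ R := by simpa using hR hx
  have h2 : ∀ i, |(x i : ℝ)| ≤ R := fun i => by
    simpa [latticePoint] using (norm_le_pi_norm (latticePoint x) i).trans h1
  refine ⟨fun i => ?_, fun i => ?_⟩
  · have h3 := (abs_le.1 (h2 i)).1
    have h4 := Int.le_ceil R
    have : (-⌈R⌉ : ℝ) ≤ x i := by linarith
    exact_mod_cast this
  · have h3 := (abs_le.1 (h2 i)).2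
    have h4 := Int.le_ceil R
    have : (x i : ℝ) ≤ ⌈R⌉ := by linarith
    exact_mod_cast this

/-! ### Sums over slices of a cone -/

section Slices

variable {d : ℕ}

/-- The integer points `x` with `x / n ∈ A`. -/
def slice (A : Set (Fin d → ℝ)) (n : ℕ) : Set (Fin d → ℤ) :=
  {x | (n : ℝ)⁻¹ • latticePoint x ∈ A}

lemma finite_slice {A : Set (Fin d → ℝ)} (hA : Bornology.IsBounded A) {n : ℕ} (hn : 1 ≤ n) :
    (slice A n).Finite := by
  refine (finite_latticePoint_preimage (hA.smul₀ (n : ℝ))).subset fun x hx => ?_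
  have hn0 : (n : ℝ) ≠ 0 := by positivity
  exact (Set.mem_smul_set_iff_inv_smul_mem₀ hn0 _ _).2 hx

lemma dilatePoints_eq_slice (A : Set (Fin d → ℝ)) {n : ℕ} (hn : 1 ≤ n) :
    dilatePoints A n = slice A n := by
  have hn0 : (n : ℝ) ≠ 0 := by positivity
  ext x
  exact Set.mem_smul_set_iff_inv_smul_mem₀ hn0 _ _

/-- The sum of the squares of `ℓ` over the `n`-th slice of the cone over `A × {1}`. -/
noncomputable def sliceSum (ℓ : ((Fin d → ℝ) × ℝ) →ₗ[ℝ] ℝ) (A : Set (Fin d → ℝ)) (n : ℕ) : ℝ :=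
  ∑ᶠ x ∈ slice A n, ℓ (latticePoint x, (n : ℝ)) ^ 2

lemma sliceSum_union_add_inter (ℓ : ((Fin d → ℝ) × ℝ) →ₗ[ℝ] ℝ) {A B : Set (Fin d → ℝ)}
    (hA : Bornology.IsBounded A) (hB : Bornology.IsBounded B) {n : ℕ} (hn : 1 ≤ n) :
    sliceSum ℓ (A ∪ B) n + sliceSum ℓ (A ∩ B) n = sliceSum ℓ A n + sliceSum ℓ B n :=
  finsum_mem_union_inter (finite_slice hA hn) (finite_slice hB hn)

lemma sliceSum_union (ℓ : ((Fin d → ℝ) × ℝ) →ₗ[ℝ] ℝ) {A B : Set (Fin d → ℝ)}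
    (hA : Bornology.IsBounded A) (hB : Bornology.IsBounded B) (hAB : A ∩ B = ∅) {n : ℕ}
    (hn : 1 ≤ n) : sliceSum ℓ (A ∪ B) n = sliceSum ℓ A n + sliceSum ℓ B n := by
  have h0 : sliceSum ℓ (∅ : Set (Fin d → ℝ)) n = 0 := by
    simp [sliceSum, slice]
  rw [← sliceSum_union_add_inter ℓ hA hB hn, hAB, h0, add_zero]

/-- The sums over the slices of `A` are the values of a quartic polynomial vanishing at zero, whose
values at negative integers are, up to the sign `ε`, the sums over the slices of `A'`. -/
def IsReciprocal (ℓ : ((Fin d → ℝ) × ℝ) →ₗ[ℝ] ℝ) (A A' : Set (Fin d → ℝ)) (ε : ℝ) : Prop :=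
  ∃ f, IsQuartic f ∧ f 0 = 0 ∧ ∀ n : ℕ, 1 ≤ n →
    sliceSum ℓ A n = f n ∧ sliceSum ℓ A' n = ε * f (-n)

end Slices

/-! ### Lattice triangles and their edges -/

section Triangle

variable (b : AffineBasis (Fin 3) ℝ (Fin 2 → ℝ))

/-- The homogenized barycentric coordinates on integer vectors. -/
noncomputable def coneCoord (i : Fin 3) : ((Fin 2 → ℤ) × ℤ) →+ ℝ where
  toFun y := (b.coord i).linear (latticePoint y.1) + y.2 * b.coord i 0
  map_zero' := by
    have : latticePoint (0 : Fin 2 → ℤ) = 0 := by ext; simp [latticePoint]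
    simp [this]
  map_add' y z := by
    simp only [Prod.fst_add, Prod.snd_add, latticePoint_add, map_add, Int.cast_add]
    ring

lemma linear_add_coord_zero (i : Fin 3) (q : Fin 2 → ℝ) :
    (b.coord i).linear q + b.coord i 0 = b.coord i q := by
  have := congrFun (AffineMap.decomp (b.coord i)) q
  simpa using this.symm

lemma coneCoord_eq (i : Fin 3) (x : Fin 2 → ℤ) {n : ℕ} (hn : 1 ≤ n) :
    coneCoord b i (x, (n : ℤ)) = n * b.coord i ((n : ℝ)⁻¹ • latticePoint x) := by
  have hn0 : (n : ℝ) ≠ 0 := by positivity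
  rw [← linear_add_coord_zero, map_smul]
  simp only [coneCoord, AddMonoidHom.coe_mk, ZeroHom.coe_mk, smul_eq_mul, Int.cast_natCast]
  field_simp

lemma sum_coneCoord (y : (Fin 2 → ℤ) × ℤ) : (y.2 : ℝ) = ∑ i, coneCoord b i y := by
  have h0 := b.sum_coord_apply_eq_one 0
  have h1 := b.sum_coord_apply_eq_one (latticePoint y.1)
  simp only [← linear_add_coord_zero b _ (latticePoint y.1), Finset.sum_add_distrib, h0] at h1
  simp only [coneCoord, AddMonoidHom.coe_mk, ZeroHom.coe_mk, Finset.sum_add_distrib,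
    ← Finset.mul_sum, h0]
  linarith

lemma eq_zero_of_coneCoord {y : (Fin 2 → ℤ) × ℤ} (h : ∀ i, coneCoord b i y = 0) : y = 0 := by
  have h2 : y.2 = 0 := by
    have := sum_coneCoord b y
    simp only [h, Finset.sum_const_zero] at this
    exact_mod_cast this
  have h1 : latticePoint y.1 = 0 := by
    refine b.ext_elem fun i => ?_
    have := h i
    simp only [coneCoord, AddMonoidHom.coe_mk, ZeroHom.coe_mk, h2, Int.cast_zero, zero_mul,
      add_zero] at this
    rw [← linear_add_coord_zero, this, zero_add]
  refine Prod.ext (funext fun i => ?_) h2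
  have := congrFun h1 i
  simpa [latticePoint] using this

/-- A linear form on `ℝ^d × ℝ` restricted to integer points. -/
noncomputable def integerWeight {d : ℕ} (ℓ : ((Fin d → ℝ) × ℝ) →ₗ[ℝ] ℝ) :
    ((Fin d → ℤ) × ℤ) →+ ℝ where
  toFun y := ℓ (latticePoint y.1, (y.2 : ℝ))
  map_zero' := by
    have : latticePoint (0 : Fin d → ℤ) = 0 := by ext; simp [latticePoint]
    simp only [Prod.fst_zero, Prod.snd_zero, this, Int.cast_zero]
    exact map_zero ℓ
  map_add' y z := by
    simp only [Prod.fst_add, Prod.snd_add, latticePoint_add, Int.cast_add]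
    rw [← map_add]; rfl

variable {b} {v : Fin 3 → Fin 2 → ℤ}

lemma coneCoord_vertex (hv : ∀ i, b i = latticePoint (v i)) (i j : Fin 3) :
    coneCoord b i (v j, 1) = if i = j then 1 else 0 := by
  have := linear_add_coord_zero b i (latticePoint (v j))
  simp only [coneCoord, AddMonoidHom.coe_mk, ZeroHom.coe_mk, Int.cast_one, one_mul, this]
  rw [← hv, b.coord_apply]

/-- A box point has height `h` in `{0, 1, 2}`; adding `3 - h` copies of the first vertex moves it
into the third dilate of the triangle, which is bounded. -/
lemma finite_coneCoord_box (hv : ∀ i, b i = latticePoint (v i)) :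
    {y | ∀ i, 0 ≤ coneCoord b i y ∧ coneCoord b i y < 1}.Finite := by
  have hfin : (slice (convexHull ℝ (Set.range b)) 3).Finite :=
    finite_slice ((isBounded_convexHull).2 (Set.finite_range b).isBounded) (by norm_num)
  refine ((hfin.prod (Set.finite_Icc (0 : ℤ) 2)).image
    fun p => (p.1 - (3 - p.2) • v 0, p.2)).subset ?_
  rintro ⟨x, h⟩ hy
  have hs := sum_coneCoord b (x, h)
  have h0 : (0 : ℝ) ≤ h := by
    rw [hs]; exact Finset.sum_nonneg fun i _ => (hy i).1
  have h3 : (h : ℝ) < 3 := by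
    rw [hs, Fin.sum_univ_three]
    linarith [(hy 0).2, (hy 1).2, (hy 2).2]
  have h0' : 0 ≤ h := by exact_mod_cast h0
  have h3' : h < 3 := by exact_mod_cast h3
  refine ⟨(x + (3 - h) • v 0, h), ⟨?_, h0', by omega⟩, by simp⟩
  change _ ∈ convexHull ℝ (Set.range b)
  rw [b.convexHull_eq_nonneg_coord]
  intro i
  have e1 : ((x + (3 - h) • v 0, ((3 : ℕ) : ℤ)) : (Fin 2 → ℤ) × ℤ) =
      (x, h) + (3 - h) • (v 0, (1 : ℤ)) := by
    ext <;> simp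
  have e2 := coneCoord_eq b i (x + (3 - h) • v 0) (n := 3) (by norm_num)
  rw [e1, map_add, map_zsmul, coneCoord_vertex hv, zsmul_eq_mul] at e2
  have h5 : (0 : ℝ) ≤ ((3 - h : ℤ) : ℝ) * (if i = 0 then 1 else 0) := by
    push_cast
    split_ifs <;> linarith
  have := (hy i).1
  push_cast at e2 h5 ⊢
  linarith

lemma isReciprocal_triangle (hv : ∀ i, b i = latticePoint (v i))
    (ℓ : ((Fin 2 → ℝ) × ℝ) →ₗ[ℝ] ℝ) :
    IsReciprocal ℓ (convexHull ℝ (Set.range b)) (interior (convexHull ℝ (Set.range b))) 1 := by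
  obtain ⟨f, hf, hf0, hfn⟩ := exists_quartic_of_cone_fin_three (V := fun i => (v i, (1 : ℤ)))
    (c := coneCoord b) (ht := AddMonoidHom.snd _ _) (w := integerWeight ℓ)
    (coneCoord_vertex hv) (finite_coneCoord_box hv) (sum_coneCoord b)
    (fun y hy => by rw [eq_zero_of_coneCoord b hy, map_zero])
  refine ⟨f, hf, hf0, fun n hn => ?_⟩
  obtain ⟨h1, h2⟩ := hfn n hn
  have hn0 : (0 : ℝ) < n := by positivity
  rw [one_mul, ← h1, ← h2]
  constructor
  · refine finsum_mem_eq_of_bijOn (fun x => (x, (n : ℤ))) ⟨?_, ?_, ?_⟩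
      (fun x _ => by simp [integerWeight])
    · intro x hx
      change _ ∈ convexHull ℝ (Set.range b) at hx
      rw [b.convexHull_eq_nonneg_coord] at hx
      refine ⟨fun i => ?_, rfl⟩
      rw [coneCoord_eq b i x hn]
      exact mul_nonneg hn0.le (hx i)
    · intro x _ y _ h; exact (Prod.ext_iff.1 h).1
    · rintro ⟨x, h⟩ ⟨hx, hh⟩
      obtain rfl : h = n := hh
      refine ⟨x, ?_, rfl⟩
      change _ ∈ convexHull ℝ (Set.range b)
      rw [b.convexHull_eq_nonneg_coord]
      intro i
      have := hx i
      rw [coneCoord_eq b i x hn] at this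
      exact nonneg_of_mul_nonneg_right this hn0
  · refine finsum_mem_eq_of_bijOn (fun x => (x, (n : ℤ))) ⟨?_, ?_, ?_⟩
      (fun x _ => by simp [integerWeight])
    · intro x hx
      change _ ∈ interior (convexHull ℝ (Set.range b)) at hx
      rw [b.interior_convexHull] at hx
      refine ⟨fun i => ?_, rfl⟩
      rw [coneCoord_eq b i x hn]
      exact mul_pos hn0 (hx i)
    · intro x _ y _ h; exact (Prod.ext_iff.1 h).1
    · rintro ⟨x, h⟩ ⟨hx, hh⟩
      obtain rfl : h = n := hh
      refine ⟨x, ?_, rfl⟩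
      change _ ∈ interior (convexHull ℝ (Set.range b))
      rw [b.interior_convexHull]
      intro i
      have := hx i
      rw [coneCoord_eq b i x hn] at this
      exact pos_of_mul_pos_right this hn0.le

variable (b) in
/-- The edge of the triangle opposite the last vertex. -/
def edge : Set (Fin 2 → ℝ) := {q | b.coord 2 q = 0 ∧ 0 ≤ b.coord 0 q ∧ 0 ≤ b.coord 1 q}

variable (b) in
/-- The relative interior of the edge opposite the last vertex. -/
def openEdge : Set (Fin 2 → ℝ) := {q | b.coord 2 q = 0 ∧ 0 < b.coord 0 q ∧ 0 < b.coord 1 q}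

/-- The two-generator cone lives in the subgroup where the third cone coordinate vanishes. -/
lemma isReciprocal_edge (hv : ∀ i, b i = latticePoint (v i))
    (ℓ : ((Fin 2 → ℝ) × ℝ) →ₗ[ℝ] ℝ) : IsReciprocal ℓ (edge b) (openEdge b) (-1) := by
  obtain ⟨f, hf, hf0, hfn⟩ := exists_quartic_of_cone_fin_two (G := (coneCoord b 2).ker)
    (V := fun i => ⟨(v i.castSucc, (1 : ℤ)), by
      rw [AddMonoidHom.mem_ker, coneCoord_vertex hv, if_neg (by fin_cases i <;> decide)]⟩)
    (c := fun i => (coneCoord b i.castSucc).comp (AddSubgroup.subtype _))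
    (ht := (AddMonoidHom.snd _ _).comp (AddSubgroup.subtype _))
    (w := (integerWeight ℓ).comp (AddSubgroup.subtype _))
    (fun i j => by simp [coneCoord_vertex hv])
    (((finite_coneCoord_box hv).preimage Subtype.val_injective.injOn).subset (by
      intro y hy
      have h2 : coneCoord b 2 y.1 = 0 := y.2
      rw [Set.mem_preimage, Set.mem_ofPred_eq, Fin.forall_fin_succ', show Fin.last 2 = 2 from rfl, h2]
      exact ⟨hy, by norm_num⟩))
    (fun y => by
      have h2 : coneCoord b 2 y.1 = 0 := y.2
      have := sum_coneCoord b y.1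
      rw [Fin.sum_univ_castSucc, show Fin.last 2 = 2 from rfl, h2, add_zero] at this
      exact this)
    (fun y hy => by
      have h2 : coneCoord b 2 y.1 = 0 := y.2
      have : y.1 = 0 := by
        refine eq_zero_of_coneCoord b ?_
        rw [Fin.forall_fin_succ']
        exact ⟨hy, h2⟩
      simp [this])
  refine ⟨f, hf, hf0, fun n hn => ?_⟩
  obtain ⟨h1, h2⟩ := hfn n hn
  have hn0 : (0 : ℝ) < n := by positivity
  rw [neg_one_mul, ← h1, ← h2]
  constructor
  · symm
    refine finsum_mem_eq_of_bijOn (fun y => y.1.1) ⟨?_, ?_, ?_⟩ ?_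
    · rintro ⟨⟨x, h⟩, hy⟩ ⟨hx, hh⟩
      obtain rfl : h = n := hh
      rw [AddMonoidHom.mem_ker, coneCoord_eq b 2 x hn] at hy
      have hx0 := hx 0
      have hx1 := hx 1
      simp only [AddMonoidHom.comp_apply, AddSubgroup.subtype_apply, Fin.castSucc_zero,
        Fin.castSucc_one, coneCoord_eq b _ x hn] at hx0 hx1
      exact ⟨by simpa [hn0.ne'] using hy, nonneg_of_mul_nonneg_right hx0 hn0,
        nonneg_of_mul_nonneg_right hx1 hn0⟩
    · rintro ⟨⟨x, h⟩, _⟩ ⟨_, hh⟩ ⟨⟨x', h'⟩, _⟩ ⟨_, hh'⟩ hxx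
      obtain rfl : h = n := hh
      obtain rfl : h' = n := hh'
      obtain rfl : x = x' := hxx
      rfl
    · rintro x ⟨hx2, hx0, hx1⟩
      refine ⟨⟨(x, (n : ℤ)), ?_⟩, ⟨?_, rfl⟩, rfl⟩
      · rw [AddMonoidHom.mem_ker, coneCoord_eq b 2 x hn, hx2, mul_zero]
      · intro i
        simp only [AddMonoidHom.comp_apply, AddSubgroup.subtype_apply, coneCoord_eq b _ x hn]
        fin_cases i
        · exact mul_nonneg hn0.le hx0
        · exact mul_nonneg hn0.le hx1
    · rintro ⟨⟨x, h⟩, _⟩ ⟨_, hh⟩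
      obtain rfl : h = n := hh
      simp [integerWeight]
  · symm
    refine finsum_mem_eq_of_bijOn (fun y => y.1.1) ⟨?_, ?_, ?_⟩ ?_
    · rintro ⟨⟨x, h⟩, hy⟩ ⟨hx, hh⟩
      obtain rfl : h = n := hh
      rw [AddMonoidHom.mem_ker, coneCoord_eq b 2 x hn] at hy
      have hx0 := hx 0
      have hx1 := hx 1
      simp only [AddMonoidHom.comp_apply, AddSubgroup.subtype_apply, Fin.castSucc_zero,
        Fin.castSucc_one, coneCoord_eq b _ x hn] at hx0 hx1
      exact ⟨by simpa [hn0.ne'] using hy, pos_of_mul_pos_right hx0 hn0.le,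
        pos_of_mul_pos_right hx1 hn0.le⟩
    · rintro ⟨⟨x, h⟩, _⟩ ⟨_, hh⟩ ⟨⟨x', h'⟩, _⟩ ⟨_, hh'⟩ hxx
      obtain rfl : h = n := hh
      obtain rfl : h' = n := hh'
      obtain rfl : x = x' := hxx
      rfl
    · rintro x ⟨hx2, hx0, hx1⟩
      refine ⟨⟨(x, (n : ℤ)), ?_⟩, ⟨?_, rfl⟩, rfl⟩
      · rw [AddMonoidHom.mem_ker, coneCoord_eq b 2 x hn, hx2, mul_zero]
      · intro i
        simp only [AddMonoidHom.comp_apply, AddSubgroup.subtype_apply, coneCoord_eq b _ x hn]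
        fin_cases i
        · exact mul_pos hn0 hx0
        · exact mul_pos hn0 hx1
    · rintro ⟨⟨x, h⟩, _⟩ ⟨_, hh⟩
      obtain rfl : h = n := hh
      simp [integerWeight]

end Triangle

/-! ### Cutting a convex hull by a half-space -/

section Cutting

variable {E : Type*} [AddCommGroup E] [Module ℝ E]

/-- A half plane cuts the convex hull of `S` in the convex hull of the points of `S` it contains,
as soon as the points of the convex hull on the boundary line are of this kind. -/
lemma convexHull_inter_halfspace (S : Finset E) (g : E →ᵃ[ℝ] ℝ)
    {S₁ : Finset E} (hS₁ : ∀ p, p ∈ S₁ ↔ p ∈ S ∧ g p ≤ 0)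
    (h : ∀ z ∈ convexHull ℝ (S : Set E), g z = 0 → z ∈ convexHull ℝ (S₁ : Set E)) :
    convexHull ℝ (S : Set E) ∩ g ⁻¹' Set.Iic 0 = convexHull ℝ (S₁ : Set E) := by
  have hsub : convexHull ℝ (S₁ : Set E) ⊆ convexHull ℝ (S : Set E) :=
    convexHull_mono fun p hp => ((hS₁ p).1 hp).1
  have hle : convexHull ℝ (S₁ : Set E) ⊆ g ⁻¹' Set.Iic 0 :=
    convexHull_min (fun p hp => ((hS₁ p).1 hp).2) ((convex_Iic (0 : ℝ)).affine_preimage g)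
  refine Set.Subset.antisymm ?_ (Set.subset_inter hsub hle)
  rintro x ⟨hx, hgx⟩
  set S₂ : Set E := {p | p ∈ S ∧ 0 < g p} with hS₂
  have hgt : convexHull ℝ S₂ ⊆ g ⁻¹' Set.Ioi 0 :=
    convexHull_min (fun p hp => hp.2) ((convex_Ioi (0 : ℝ)).affine_preimage g)
  have hun : (S : Set E) = (S₁ : Set E) ∪ S₂ := by
    ext p
    simp only [Set.mem_union, Finset.mem_coe, hS₁, hS₂, Set.mem_ofPred_eq]
    rw [← and_or_left]
    simp [le_or_gt]
  rcases Set.eq_empty_or_nonempty (S₁ : Set E) with h1 | h1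
  · rw [hun, h1, Set.empty_union] at hx
    exact absurd (show 0 < g x from hgt hx) (not_lt.2 hgx)
  rcases Set.eq_empty_or_nonempty S₂ with h2 | h2
  · rwa [hun, h2, Set.union_empty] at hx
  have hx' := hx
  rw [hun, convexHull_union h1 h2, mem_convexJoin] at hx'
  obtain ⟨p, hp, q, hq, α, β, hα, hβ, hαβ, rfl⟩ := hx'
  have hgp : g p ≤ 0 := hle hp
  have hgq : 0 < g q := hgt hq
  have hgx : α * g p + β * g q ≤ 0 := by
    have : g (α • p + β • q) ≤ 0 := hgx
    rwa [Convex.combo_affine_apply hαβ, smul_eq_mul, smul_eq_mul] at this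
  rcases hgp.eq_or_lt with hp0 | hp0
  · have : β = 0 := by rw [hp0] at hgx; nlinarith
    subst this
    have : α = 1 := by linarith
    subst this
    simpa using hp
  have hd : 0 < g q - g p := by linarith
  have hz1 : g q / (g q - g p) + -g p / (g q - g p) = 1 := by field_simp; ring
  -- This is where the segment from `p` to `q` crosses `g = 0`; the given point lies between `p` and
  -- this crossing.
  have hz : (g q / (g q - g p)) • p + (-g p / (g q - g p)) • q ∈ convexHull ℝ (S₁ : Set E) := by
    refine h _ ?_ ?_
    · refine convex_convexHull ℝ _ (hsub hp) ?_ (by positivity) (div_nonneg (by linarith) hd.le) hz1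
      exact convexHull_mono (fun p hp => hp.1) hq
    · rw [Convex.combo_affine_apply hz1, smul_eq_mul, smul_eq_mul]
      field_simp
      ring
  have key : α • p + β • q = (1 - β * (g q - g p) / -g p) • p + (β * (g q - g p) / -g p) •
      ((g q / (g q - g p)) • p + (-g p / (g q - g p)) • q) := by
    have hα' : α = 1 - β := by linarith
    subst hα'
    match_scalars
    · have := hp0.ne
      field_simp
      ring
    · have := hp0.ne
      field_simp
  rw [key]
  refine convex_convexHull ℝ _ hp hz ?_ (div_nonneg (by positivity) (by linarith)) (by ring)
  rw [sub_nonneg, div_le_one (by linarith)]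
  have : α = 1 - β := by linarith
  subst this
  linarith

end Cutting

/-! ### Dissection of polygons along diagonals -/

section Plane

variable {b : AffineBasis (Fin 3) ℝ (Fin 2 → ℝ)}

/-- If `z` lay on the edge line beyond `b j`, then `b j` would be strictly between `z` and `b i`.
Removing the share of `b j` in `z` would then express `b j` through the other points of `S`. -/
lemma coord_nonneg_of_convexIndependent {S : Finset (Fin 2 → ℝ)}
    (hconv : ∀ p ∈ S, p ∉ convexHull ℝ ((S.erase p : Finset (Fin 2 → ℝ)) : Set (Fin 2 → ℝ)))
    (hb : ∀ i, b i ∈ S) {i j l : Fin 3} (hij : i ≠ j) (hil : i ≠ l) (hjl : j ≠ l)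
    {z : Fin 2 → ℝ} (hz : z ∈ convexHull ℝ (S : Set (Fin 2 → ℝ))) (hl : b.coord l z = 0) :
    0 ≤ b.coord i z := by
  classical
  by_contra! hneg
  have hall : ∀ m : Fin 3, m = i ∨ m = j ∨ m = l := by
    clear hl hneg
    revert i j l; decide
  have hsum : b.coord i z + b.coord j z + b.coord l z = 1 := by
    rw [← b.sum_coord_apply_eq_one z]
    have : (Finset.univ : Finset (Fin 3)) = {i, j, l} := by ext m; simp [hall m]
    rw [this, Finset.sum_insert (by simp [hij, hil]), Finset.sum_pair hjl, add_assoc]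
  set β := b.coord j z with hβ
  have hβ1 : 1 < β := by linarith
  have hβ0 : β ≠ 0 := by positivity
  have hcomb : β⁻¹ + (1 - β⁻¹) = 1 := by ring
  have hbj : b j = β⁻¹ • z + (1 - β⁻¹) • b i := by
    refine b.ext_elem fun m => ?_
    rw [Convex.combo_affine_apply hcomb, smul_eq_mul, smul_eq_mul]
    rcases hall m with rfl | rfl | rfl
    · rw [b.coord_apply_ne hij, b.coord_apply_eq]
      have : b.coord m z = 1 - β := by linarith
      rw [this]; field_simp; ring
    · rw [b.coord_apply_ne hij.symm, b.coord_apply_eq, ← hβ]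
      field_simp; ring
    · rw [b.coord_apply_ne hjl.symm, b.coord_apply_ne hil.symm, hl]; ring
  have hbi : b i ∈ S.erase (b j) :=
    Finset.mem_erase.2 ⟨b.ind.injective.ne hij, hb i⟩
  rw [← Finset.insert_erase (hb j), Finset.coe_insert, convexHull_insert ⟨_, hbi⟩,
    mem_convexJoin] at hz
  obtain ⟨_, rfl, z', hz', lam, μ, hlam, hμ, hsum1, hzz⟩ := hz
  refine hconv (b j) (hb j) ?_
  have hμ' : μ = 1 - lam := by linarith
  subst hμ'
  have hlt : lam < β := by linarith
  have hd : 0 < β - lam := by linarith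
  have heq : b j = ((1 - lam) / (β - lam)) • z' + ((β - 1) / (β - lam)) • b i := by
    have h1 : (β - lam) • b j = (1 - lam) • z' + (β - 1) • b i := by
      have h2 : β • b j = z + (β - 1) • b i := by
        conv_lhs => rw [hbj]
        rw [smul_add, smul_smul, smul_smul, mul_inv_cancel₀ hβ0, one_smul]
        congr 2
        field_simp
      rw [sub_smul, h2, ← hzz]
      abel
    rw [div_eq_inv_mul, div_eq_inv_mul, mul_smul, mul_smul, ← smul_add, ← h1, smul_smul,
      inv_mul_cancel₀ hd.ne', one_smul]
  have hmem := convex_convexHull ℝ _ hz' (subset_convexHull ℝ _ hbi)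
    (div_nonneg hμ hd.le) (div_nonneg (sub_nonneg.2 hβ1.le) hd.le) (by field_simp; ring)
  rwa [← heq] at hmem

/-- An interior point on the line can be moved both ways along it, so it is not an endpoint.
Conversely, the intermediate value theorem gives one interior point on the line, and every point of
the open edge lies between it and an endpoint, short of the endpoint. -/
lemma interior_inter_edgeLine {K : Set (Fin 2 → ℝ)} (hK : Convex ℝ K) (hb : ∀ i, b i ∈ K)
    (hedge : ∀ z ∈ K, b.coord 2 z = 0 → z ∈ edge b)
    (hpos : (interior K ∩ b.coord 2 ⁻¹' Set.Ioi 0).Nonempty)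
    (hneg : (interior K ∩ b.coord 2 ⁻¹' Set.Iio 0).Nonempty) :
    interior K ∩ b.coord 2 ⁻¹' {0} = openEdge b := by
  have hcont : ∀ i, Continuous (b.coord i) := continuous_barycentric_coord b
  have hsum : ∀ z, b.coord 0 z + b.coord 1 z + b.coord 2 z = 1 := fun z => by
    rw [← b.sum_coord_apply_eq_one z, Fin.sum_univ_three]
  have hsub : interior K ∩ b.coord 2 ⁻¹' {0} ⊆ openEdge b := by
    rintro z ⟨hz, hz2⟩
    have hz2 : b.coord 2 z = 0 := hz2
    have hev : ∀ᶠ τ in nhds (0 : ℝ), z + τ • (b 0 - b 1) ∈ K := by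
      have hc : Continuous fun τ : ℝ => z + τ • (b 0 - b 1) := by fun_prop
      have : interior K ∈ nhds (z + (0 : ℝ) • (b 0 - b 1)) := by
        rw [zero_smul, add_zero]
        exact isOpen_interior.mem_nhds hz
      exact (hc.continuousAt.eventually this).mono fun τ hτ => interior_subset hτ
    obtain ⟨ε, hε, hball⟩ := Metric.eventually_nhds_iff.1 hev
    have hcoord : ∀ i τ, b.coord i (z + τ • (b 0 - b 1)) =
        b.coord i z + τ * (b.coord i (b 0) - b.coord i (b 1)) := by
      intro i τ
      have h := linear_add_coord_zero b i
      rw [← h (z + τ • (b 0 - b 1)), ← h z, ← h (b 0), ← h (b 1), map_add, map_smul, map_sub,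
        smul_eq_mul]
      ring
    have mem : ∀ τ, |τ| < ε → z + τ • (b 0 - b 1) ∈ edge b := by
      intro τ hτ
      refine hedge _ (hball (by simpa using hτ)) ?_
      rw [hcoord, hz2, b.coord_apply_ne (by decide), b.coord_apply_ne (by decide)]
      ring
    have hε2 : |ε / 2| < ε := by rw [abs_of_pos (by positivity)]; linarith
    have h1 := (mem (ε / 2) hε2).2.2
    have h2 := (mem (-(ε / 2)) (by rwa [abs_neg])).2.1
    rw [hcoord, b.coord_apply_ne (show (1 : Fin 3) ≠ 0 by decide), b.coord_apply_eq] at h1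
    rw [hcoord, b.coord_apply_ne (show (0 : Fin 3) ≠ 1 by decide), b.coord_apply_eq] at h2
    exact ⟨hz2, by linarith, by linarith⟩
  refine Set.Subset.antisymm hsub ?_
  obtain ⟨p, hp, hp2⟩ := hpos
  obtain ⟨n, hn, hn2⟩ := hneg
  obtain ⟨z, hz, hz2⟩ := hK.interior.isPreconnected.intermediate_value hn hp
    (hcont 2).continuousOn ⟨le_of_lt hn2, le_of_lt hp2⟩
  have hzE := hsub ⟨hz, hz2⟩
  rintro y ⟨hy2, hy0, hy1⟩
  refine ⟨?_, hy2⟩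
  obtain ⟨-, hz0, hz1⟩ := hzE
  have hsz := hsum z
  have hsy := hsum y
  rw [hz2, add_zero] at hsz
  rw [hy2, add_zero] at hsy
  rcases le_total (b.coord 0 z) (b.coord 0 y) with hle | hle
  · have hab : b.coord 1 y / b.coord 1 z + (1 - b.coord 1 y / b.coord 1 z) = 1 := by ring
    have : y = (b.coord 1 y / b.coord 1 z) • z + (1 - b.coord 1 y / b.coord 1 z) • b 0 := by
      refine b.ext_elem fun m => ?_
      rw [Convex.combo_affine_apply hab, smul_eq_mul, smul_eq_mul]
      fin_cases m
      · simp only [Fin.zero_eta, b.coord_apply_eq]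
        have e1 : b.coord 0 z = 1 - b.coord 1 z := by linarith
        have e2 : b.coord 0 y = 1 - b.coord 1 y := by linarith
        rw [e1, e2]; field_simp; ring
      · simp only [Fin.mk_one, b.coord_apply_ne (show (1 : Fin 3) ≠ 0 by decide)]
        field_simp; ring
      · simp only [Fin.reduceFinMk, b.coord_apply_ne (show (2 : Fin 3) ≠ 0 by decide), hy2, hz2]
        ring
    rw [this]
    refine hK.combo_interior_self_mem_interior hz (hb 0) (by positivity) ?_ hab
    rw [sub_nonneg, div_le_one hz1]
    linarith
  · have hab : b.coord 0 y / b.coord 0 z + (1 - b.coord 0 y / b.coord 0 z) = 1 := by ring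
    have : y = (b.coord 0 y / b.coord 0 z) • z + (1 - b.coord 0 y / b.coord 0 z) • b 1 := by
      refine b.ext_elem fun m => ?_
      rw [Convex.combo_affine_apply hab, smul_eq_mul, smul_eq_mul]
      fin_cases m
      · simp only [Fin.zero_eta, b.coord_apply_ne (show (0 : Fin 3) ≠ 1 by decide)]
        field_simp; ring
      · simp only [Fin.mk_one, b.coord_apply_eq]
        have e1 : b.coord 1 z = 1 - b.coord 0 z := by linarith
        have e2 : b.coord 1 y = 1 - b.coord 0 y := by linarith
        rw [e1, e2]; field_simp; ring
      · simp only [Fin.reduceFinMk, b.coord_apply_ne (show (2 : Fin 3) ≠ 1 by decide), hy2, hz2]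
        ring
    rw [this]
    refine hK.combo_interior_self_mem_interior hz (hb 1) (by positivity) ?_ hab
    rw [sub_nonneg, div_le_one hz0]
    linarith

/-- A convex lattice polygon in convex position with a vertex on the far side of an edge of an
inscribed triangle is cut by this edge. -/
lemma isReciprocal_of_cut {ℓ : ((Fin 2 → ℝ) × ℝ) →ₗ[ℝ] ℝ} {S S₁ S₂ : Finset (Fin 2 → ℝ)}
    (hint : (interior (convexHull ℝ (S : Set (Fin 2 → ℝ)))).Nonempty)
    (hconv : ∀ p ∈ S, p ∉ convexHull ℝ ((S.erase p : Finset (Fin 2 → ℝ)) : Set (Fin 2 → ℝ)))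
    (hb : ∀ i, b i ∈ S) {t : Fin 2 → ℝ} (ht : t ∈ S) (ht2 : b.coord 2 t < 0)
    (hS₁ : ∀ p, p ∈ S₁ ↔ p ∈ S ∧ b.coord 2 p ≤ 0) (hS₂ : ∀ p, p ∈ S₂ ↔ p ∈ S ∧ 0 ≤ b.coord 2 p)
    (hE : IsReciprocal ℓ (edge b) (openEdge b) (-1))
    (ih : ∀ T : Finset (Fin 2 → ℝ), T ⊂ S →
      (interior (convexHull ℝ (T : Set (Fin 2 → ℝ)))).Nonempty →
      IsReciprocal ℓ (convexHull ℝ (T : Set (Fin 2 → ℝ)))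
        (interior (convexHull ℝ (T : Set (Fin 2 → ℝ)))) 1) :
    IsReciprocal ℓ (convexHull ℝ (S : Set (Fin 2 → ℝ)))
      (interior (convexHull ℝ (S : Set (Fin 2 → ℝ)))) 1 := by
  classical
  set K := convexHull ℝ (S : Set (Fin 2 → ℝ)) with hK
  have hKc : Convex ℝ K := convex_convexHull ℝ _
  have hKb : Bornology.IsBounded K := isBounded_convexHull.2 S.finite_toSet.isBounded
  have hcont : Continuous (b.coord 2) := continuous_barycentric_coord b 2
  have hopen : IsOpenMap (b.coord 2) := isOpenMap_barycentric_coord b 2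
  have hsum : ∀ z, b.coord 0 z + b.coord 1 z + b.coord 2 z = 1 := fun z => by
    rw [← b.sum_coord_apply_eq_one z, Fin.sum_univ_three]
  have hedge : ∀ z ∈ K, b.coord 2 z = 0 → z ∈ edge b := fun z hz hz2 =>
    ⟨hz2, coord_nonneg_of_convexIndependent hconv hb (i := 0) (j := 1) (l := 2)
      (by decide) (by decide) (by decide) hz hz2,
      coord_nonneg_of_convexIndependent hconv hb (i := 1) (j := 0) (l := 2)
      (by decide) (by decide) (by decide) hz hz2⟩
  have hedge_sub : ∀ T : Finset (Fin 2 → ℝ), b 0 ∈ T → b 1 ∈ T →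
      edge b ⊆ convexHull ℝ (T : Set (Fin 2 → ℝ)) := by
    rintro T h0 h1 z ⟨hz2, hz0, hz1⟩
    have hs := hsum z
    rw [hz2, add_zero] at hs
    have : z = b.coord 0 z • b 0 + b.coord 1 z • b 1 := by
      refine b.ext_elem fun m => ?_
      rw [Convex.combo_affine_apply hs, smul_eq_mul, smul_eq_mul]
      fin_cases m
      · simp [b.coord_apply]
      · simp [b.coord_apply]
      · simp [b.coord_apply, hz2]
    rw [this]
    exact convex_convexHull ℝ _ (subset_convexHull ℝ _ h0) (subset_convexHull ℝ _ h1) hz0 hz1 hs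
  have c20 : b.coord 2 (b 0) = 0 := b.coord_apply_ne (by decide)
  have c21 : b.coord 2 (b 1) = 0 := b.coord_apply_ne (by decide)
  have c22 : b.coord 2 (b 2) = 1 := b.coord_apply_eq 2
  have hK₁ : K ∩ b.coord 2 ⁻¹' Set.Iic 0 = convexHull ℝ (S₁ : Set (Fin 2 → ℝ)) :=
    convexHull_inter_halfspace S (b.coord 2) hS₁ fun z hz hz2 =>
      hedge_sub S₁ ((hS₁ _).2 ⟨hb 0, c20.le⟩) ((hS₁ _).2 ⟨hb 1, c21.le⟩) (hedge z hz hz2)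
  have hK₂ : K ∩ b.coord 2 ⁻¹' Set.Ici 0 = convexHull ℝ (S₂ : Set (Fin 2 → ℝ)) := by
    have := convexHull_inter_halfspace S (-(b.coord 2)) (S₁ := S₂) (fun p => by simp [hS₂])
      fun z hz hz2 => hedge_sub S₂ ((hS₂ _).2 ⟨hb 0, c20.ge⟩) ((hS₂ _).2 ⟨hb 1, c21.ge⟩)
        (hedge z hz (by simpa using hz2))
    rw [← this]
    congr 1
    ext z; simp
  have hI₁ : interior K ∩ b.coord 2 ⁻¹' Set.Iio 0 =
      interior (convexHull ℝ (S₁ : Set (Fin 2 → ℝ))) := by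
    rw [← hK₁, interior_inter, ← hopen.preimage_interior_eq_interior_preimage hcont, interior_Iic]
  have hI₂ : interior K ∩ b.coord 2 ⁻¹' Set.Ioi 0 =
      interior (convexHull ℝ (S₂ : Set (Fin 2 → ℝ))) := by
    rw [← hK₂, interior_inter, ← hopen.preimage_interior_eq_interior_preimage hcont, interior_Ici]
  have hcl : ∀ p ∈ S, p ∈ closure (interior K) := fun p hp => by
    rw [hKc.closure_interior_eq_closure_of_nonempty_interior hint]
    exact subset_closure (subset_convexHull ℝ _ hp)
  have hne₁ : (interior K ∩ b.coord 2 ⁻¹' Set.Iio 0).Nonempty := by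
    rw [Set.inter_comm]
    exact mem_closure_iff.1 (hcl t ht) _ (isOpen_Iio.preimage hcont) ht2
  have hne₂ : (interior K ∩ b.coord 2 ⁻¹' Set.Ioi 0).Nonempty := by
    rw [Set.inter_comm]
    exact mem_closure_iff.1 (hcl _ (hb 2)) _ (isOpen_Ioi.preimage hcont)
      (by simp [c22])
  have hIE : interior K ∩ b.coord 2 ⁻¹' {0} = openEdge b :=
    interior_inter_edgeLine hKc (fun i => subset_convexHull ℝ _ (hb i)) hedge hne₂ hne₁
  have hss₁ : S₁ ⊂ S := by
    refine (Finset.ssubset_iff_of_subset fun p hp => ((hS₁ p).1 hp).1).2 ⟨b 2, hb 2, fun h => ?_⟩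
    have := ((hS₁ _).1 h).2
    rw [c22] at this; linarith
  have hss₂ : S₂ ⊂ S := by
    refine (Finset.ssubset_iff_of_subset fun p hp => ((hS₂ p).1 hp).1).2 ⟨t, ht, fun h => ?_⟩
    have := ((hS₂ _).1 h).2
    linarith
  obtain ⟨f₁, hf₁, hf₁0, h₁⟩ := ih S₁ hss₁ (hI₁ ▸ hne₁)
  obtain ⟨f₂, hf₂, hf₂0, h₂⟩ := ih S₂ hss₂ (hI₂ ▸ hne₂)
  obtain ⟨f₀, hf₀, hf₀0, h₀⟩ := hE
  -- The closed pieces overlap in the edge, which is subtracted. The interiors of the pieces miss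
  -- the open edge, which is added; the sign `-1` in the reciprocity of the edge reconciles the two.
  refine ⟨fun x => f₁ x + f₂ x + -f₀ x, (hf₁.add hf₂).add hf₀.neg, by simp [hf₁0, hf₂0, hf₀0],
    fun n hn => ?_⟩
  obtain ⟨a₁, e₁⟩ := h₁ n hn
  obtain ⟨a₂, e₂⟩ := h₂ n hn
  obtain ⟨a₀, e₀⟩ := h₀ n hn
  rw [← hK₁] at a₁
  rw [← hK₂] at a₂
  rw [← hI₁] at e₁
  rw [← hI₂] at e₂
  rw [← hIE] at e₀
  constructor
  · have hU := sliceSum_union_add_inter ℓ (A := K ∩ b.coord 2 ⁻¹' Set.Iic 0)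
      (B := K ∩ b.coord 2 ⁻¹' Set.Ici 0) (hKb.subset Set.inter_subset_left)
      (hKb.subset Set.inter_subset_left) hn
    rw [← Set.inter_union_distrib_left, ← Set.preimage_union, Set.Iic_union_Ici,
      Set.preimage_univ, Set.inter_univ, ← Set.inter_inter_distrib_left, ← Set.preimage_inter,
      Set.Iic_inter_Ici, Set.Icc_self] at hU
    have hKE : K ∩ b.coord 2 ⁻¹' {0} = edge b := by
      refine Set.Subset.antisymm (fun z hz => hedge z hz.1 hz.2) fun z hz => ?_
      exact ⟨hedge_sub S (hb 0) (hb 1) hz, hz.1⟩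
    rw [hKE] at hU
    linarith
  · have hIb : Bornology.IsBounded (interior K) := hKb.subset interior_subset
    have hU := sliceSum_union ℓ (A := interior K ∩ b.coord 2 ⁻¹' Set.Iio 0)
      (B := interior K ∩ b.coord 2 ⁻¹' Set.Ici 0) (hIb.subset Set.inter_subset_left)
      (hIb.subset Set.inter_subset_left) (by
        rw [← Set.inter_inter_distrib_left, ← Set.preimage_inter, Set.Iio_inter_Ici,
          Set.Ico_self, Set.preimage_empty, Set.inter_empty]) hn
    have hU' := sliceSum_union ℓ (A := interior K ∩ b.coord 2 ⁻¹' Set.Ioi 0)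
      (B := interior K ∩ b.coord 2 ⁻¹' {0}) (hIb.subset Set.inter_subset_left)
      (hIb.subset Set.inter_subset_left) (by
        rw [← Set.inter_inter_distrib_left, ← Set.preimage_inter]
        simp) hn
    rw [← Set.inter_union_distrib_left, ← Set.preimage_union, Set.Ioi_union_left] at hU'
    rw [← Set.inter_union_distrib_left, ← Set.preimage_union, Set.Iio_union_Ici,
      Set.preimage_univ, Set.inter_univ] at hU
    linarith

/-- The weighted Ehrhart polynomial and Ehrhart–Macdonald reciprocity for lattice polygons. -/
lemma isReciprocal_convexHull (ℓ : ((Fin 2 → ℝ) × ℝ) →ₗ[ℝ] ℝ) (S : Finset (Fin 2 → ℝ))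
    (hS : ∀ p ∈ S, ∃ x : Fin 2 → ℤ, p = latticePoint x)
    (hint : (interior (convexHull ℝ (S : Set (Fin 2 → ℝ)))).Nonempty) :
    IsReciprocal ℓ (convexHull ℝ (S : Set (Fin 2 → ℝ)))
      (interior (convexHull ℝ (S : Set (Fin 2 → ℝ)))) 1 := by
  classical
  induction S using Finset.strongInduction with
  | H S ih =>
    by_cases hconv : ∀ p ∈ S,
        p ∉ convexHull ℝ ((S.erase p : Finset (Fin 2 → ℝ)) : Set (Fin 2 → ℝ))
    swap
    · push Not at hconv
      obtain ⟨p, hp, hpc⟩ := hconv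
      have heq : convexHull ℝ (S : Set (Fin 2 → ℝ)) =
          convexHull ℝ ((S.erase p : Finset (Fin 2 → ℝ)) : Set (Fin 2 → ℝ)) := by
        refine Set.Subset.antisymm (convexHull_min ?_ (convex_convexHull ℝ _))
          (convexHull_mono (Finset.erase_subset p S))
        intro q hq
        rcases eq_or_ne q p with rfl | hqp
        · exact hpc
        · exact subset_convexHull ℝ _ (Finset.mem_erase.2 ⟨hqp, hq⟩)
      rw [heq] at hint ⊢
      exact ih _ (Finset.erase_ssubset hp) (fun q hq => hS q (Finset.mem_of_mem_erase hq)) hint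
    have hspan := interior_convexHull_nonempty_iff_affineSpan_eq_top.1 hint
    obtain ⟨s, hsS, b', hb'⟩ := AffineBasis.exists_affine_subbasis hspan
    have hsfin : s.Finite := S.finite_toSet.subset hsS
    have : Fintype s := hsfin.fintype
    have hcard : Fintype.card s = 3 := by
      rw [b'.card_eq_finrank_add_one]; simp
    obtain ⟨b, hb⟩ : ∃ b : AffineBasis (Fin 3) ℝ (Fin 2 → ℝ), ∀ i, b i ∈ S := by
      refine ⟨b'.reindex (Fintype.equivFinOfCardEq hcard), fun i => ?_⟩
      rw [AffineBasis.reindex_apply, hb']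
      exact hsS (Subtype.coe_prop _)
    by_cases hall : ∀ t ∈ S, ∀ i, 0 ≤ b.coord i t
    · have heq : convexHull ℝ (S : Set (Fin 2 → ℝ)) = convexHull ℝ (Set.range b) := by
        refine Set.Subset.antisymm (convexHull_min ?_ (convex_convexHull ℝ _))
          (convexHull_mono (Set.range_subset_iff.2 hb))
        rw [b.convexHull_eq_nonneg_coord]
        exact hall
      choose v hv using fun i => hS (b i) (hb i)
      rw [heq]
      exact isReciprocal_triangle hv ℓ
    push Not at hall
    obtain ⟨t, ht, i, hti⟩ := hall
    -- Relabelling makes the cutting edge the one opposite the vertex with index 2.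
    set e := b.reindex (Equiv.swap i 2) with he
    have hbe : ∀ j, e j ∈ S := fun j => by rw [he, AffineBasis.reindex_apply]; exact hb _
    choose v hv using fun j => hS (e j) (hbe j)
    refine isReciprocal_of_cut (b := e) (S₁ := S.filter fun p => e.coord 2 p ≤ 0)
      (S₂ := S.filter fun p => 0 ≤ e.coord 2 p) hint hconv hbe ht ?_ (by simp) (by simp)
      (isReciprocal_edge hv ℓ) fun T hT hTi => ih T hT (fun p hp => hS p (hT.1 hp)) hTi
    rw [he, AffineBasis.coord_reindex]
    simpa using hti

end Plane

/-! ### Nonnegativity for polygons -/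

section Polygon

lemma mem_slice_one {d : ℕ} {A : Set (Fin d → ℝ)} {x : Fin d → ℤ} :
    x ∈ slice A 1 ↔ latticePoint x ∈ A := by
  simp [slice]

lemma add_mem_slice_two {d : ℕ} {A : Set (Fin d → ℝ)} {u v : Fin d → ℤ} :
    u + v ∈ slice A 2 ↔ (2⁻¹ : ℝ) • latticePoint u + (2⁻¹ : ℝ) • latticePoint v ∈ A := by
  simp [slice, latticePoint_add]

lemma latticePoint_eq_midpoint {d : ℕ} {u v m : Fin d → ℤ} (h : u + v = m + m) :
    latticePoint m = (2⁻¹ : ℝ) • latticePoint u + (2⁻¹ : ℝ) • latticePoint v := by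
  rw [← smul_add, ← latticePoint_add, h, latticePoint_add, ← two_smul ℝ, smul_smul]
  norm_num

lemma exists_lt_of_mem_interior_convexHull {E : Type*} [NormedAddCommGroup E] [NormedSpace ℝ E]
    {T : Set E} {p : E} (hp : p ∈ interior (convexHull ℝ T)) {χ : E →ₗ[ℝ] ℝ} (hχ : χ ≠ 0) :
    ∃ w ∈ T, χ p < χ w := by
  by_contra! hcon
  obtain ⟨e, he⟩ : ∃ e, 0 < χ e := by
    obtain ⟨e, he⟩ : ∃ e, χ e ≠ 0 := by
      by_contra! h; exact hχ (LinearMap.ext h)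
    rcases he.lt_or_gt with h | h
    · exact ⟨-e, by simpa using h⟩
    · exact ⟨e, h⟩
  have hle : convexHull ℝ T ⊆ {q | χ q ≤ χ p} :=
    convexHull_min hcon (convex_halfSpace_le χ.isLinear _)
  have hev : ∀ᶠ τ in nhds (0 : ℝ), p + τ • e ∈ convexHull ℝ T := by
    have hc : Continuous fun τ : ℝ => p + τ • e := by fun_prop
    have : interior (convexHull ℝ T) ∈ nhds (p + (0 : ℝ) • e) := by
      rw [zero_smul, add_zero]
      exact isOpen_interior.mem_nhds hp
    exact (hc.continuousAt.eventually this).mono fun τ hτ => interior_subset hτ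
  obtain ⟨ε, hε, hball⟩ := Metric.eventually_nhds_iff.1 hev
  have hε2 : (0 : ℝ) < ε / 2 := by positivity
  have h1 : χ (p + (ε / 2) • e) ≤ χ p :=
    hle (hball (by rw [dist_zero_right, Real.norm_of_nonneg hε2.le]; linarith))
  rw [map_add, map_smul, smul_eq_mul] at h1
  nlinarith

variable {S : Finset (Fin 2 → ℤ)} (ℓ : ((Fin 2 → ℝ) × ℝ) →ₗ[ℝ] ℝ)

/-- At an interior point, a linear form takes at most its value at some other generator. -/
lemma exists_ne_le_of_mem_interior {u : Fin 2 → ℤ}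
    (hu : latticePoint u ∈ interior (convexHull ℝ (latticePoint '' (S : Set (Fin 2 → ℤ))))) :
    ∃ w ∈ S, w ≠ u ∧ ℓ (latticePoint u, 1) ≤ ℓ (latticePoint w, 1) := by
  set ψ : (Fin 2 → ℝ) →ₗ[ℝ] ℝ := ℓ.comp (LinearMap.inl ℝ _ _) with hψ
  have hval : ∀ q, ℓ (q, 1) = ψ q + ℓ (0, 1) := by
    intro q
    rw [hψ, LinearMap.comp_apply, LinearMap.inl_apply, ← map_add]
    simp
  -- If `ℓ` is constant on the plane, any nonzero form serves to find a generator different from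
  -- `u`.
  by_cases h0 : ψ = 0
  · have hχ : (LinearMap.proj 0 : (Fin 2 → ℝ) →ₗ[ℝ] ℝ) ≠ 0 := by
      intro h
      have := LinearMap.congr_fun h (fun _ => 1)
      simp at this
    obtain ⟨_, ⟨w, hw, rfl⟩, hlt⟩ := exists_lt_of_mem_interior_convexHull hu hχ
    refine ⟨w, hw, ?_, ?_⟩
    · rintro rfl; exact lt_irrefl _ hlt
    · rw [hval (latticePoint u), hval (latticePoint w), h0]; simp
  · obtain ⟨_, ⟨w, hw, rfl⟩, hlt⟩ := exists_lt_of_mem_interior_convexHull hu h0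
    refine ⟨w, hw, ?_, ?_⟩
    · rintro rfl; exact lt_irrefl _ hlt
    · rw [hval (latticePoint u), hval (latticePoint w)]; linarith

lemma weight_add (u v : Fin 2 → ℤ) : ℓ (latticePoint (u + v), ((2 : ℕ) : ℝ)) =
    ℓ (latticePoint u, ((1 : ℕ) : ℝ)) + ℓ (latticePoint v, ((1 : ℕ) : ℝ)) := by
  rw [← map_add, Prod.mk_add_mk, latticePoint_add]
  norm_num

lemma five_mul_sliceSum_le {P : Set (Fin 2 → ℝ)} (hP : Convex ℝ P) (hPb : Bornology.IsBounded P)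
    (hcard : 3 ≤ (slice P 1).ncard) : 5 * sliceSum ℓ P 1 ≤ sliceSum ℓ P 2 := by
  classical
  have h1 := finite_slice hPb (n := 1) le_rfl
  have h2 := finite_slice hPb (n := 2) (by norm_num)
  unfold sliceSum
  rw [finsum_mem_eq_finite_toFinset_sum _ h1, finsum_mem_eq_finite_toFinset_sum _ h2]
  have hF := weight_add ℓ
  have hF2 : ∀ m : Fin 2 → ℤ, ℓ (latticePoint (m + m), ((2 : ℕ) : ℝ)) =
      2 * ℓ (latticePoint m, ((1 : ℕ) : ℝ)) := fun m => by rw [hF]; ring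
  have hmid : ∀ u ∈ slice P 1, ∀ v ∈ slice P 1,
      (2⁻¹ : ℝ) • latticePoint u + (2⁻¹ : ℝ) • latticePoint v ∈ P := fun u hu v hv =>
    hP (mem_slice_one.1 hu) (mem_slice_one.1 hv) (by norm_num) (by norm_num) (by norm_num)
  have hS : HalvingClosed h1.toFinset := by
    intro u hu v hv m hm
    rw [Set.Finite.mem_toFinset] at *
    rw [mem_slice_one, latticePoint_eq_midpoint hm]
    exact hmid u hu v hv
  refine five_mul_sum_sq_le hF2 ?_ (hS.sum_sq_le ?_ hF hF2 ?_)
  · intro x hx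
    rw [Set.Finite.mem_toFinset] at *
    exact add_mem_slice_two.2 (hmid x hx x hx)
  · rwa [← Set.ncard_eq_toFinset_card _ h1]
  · intro u hu v hv hd
    rw [Set.Finite.mem_toFinset] at hu hv
    rw [Finset.mem_filter, Set.Finite.mem_toFinset]
    exact ⟨add_mem_slice_two.2 (hmid u hu v hv), hd⟩

lemma five_mul_sliceSum_interior_le {P : Set (Fin 2 → ℝ)}
    (hP : P = convexHull ℝ (latticePoint '' (S : Set (Fin 2 → ℤ)))) :
    5 * sliceSum ℓ (interior P) 1 ≤ sliceSum ℓ (interior P) 2 := by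
  classical
  have hPc : Convex ℝ P := hP ▸ convex_convexHull ℝ _
  have hPb : Bornology.IsBounded P := by
    rw [hP, isBounded_convexHull]
    exact (S.finite_toSet.image _).isBounded
  have hIb : Bornology.IsBounded (interior P) := hPb.subset interior_subset
  have h0 := finite_slice hPb (n := 1) le_rfl
  have h1 := finite_slice hIb (n := 1) le_rfl
  have h2 := finite_slice hIb (n := 2) (by norm_num)
  unfold sliceSum
  rw [finsum_mem_eq_finite_toFinset_sum _ h1, finsum_mem_eq_finite_toFinset_sum _ h2]
  have hF := weight_add ℓ
  have hF2 : ∀ m : Fin 2 → ℤ, ℓ (latticePoint (m + m), ((2 : ℕ) : ℝ)) =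
      2 * ℓ (latticePoint m, ((1 : ℕ) : ℝ)) := fun m => by rw [hF]; ring
  have hmid : ∀ u ∈ slice (interior P) 1, ∀ v ∈ slice P 1,
      (2⁻¹ : ℝ) • latticePoint u + (2⁻¹ : ℝ) • latticePoint v ∈ interior P := fun u hu v hv =>
    hPc.combo_interior_self_mem_interior (mem_slice_one.1 hu) (mem_slice_one.1 hv)
      (by norm_num) (by norm_num) (by norm_num)
  have hsub : slice (interior P) 1 ⊆ slice P 1 := fun x hx => interior_subset (s := P) hx
  have hSP : ∀ w ∈ S, w ∈ h0.toFinset := by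
    intro w hw
    rw [Set.Finite.mem_toFinset, mem_slice_one, hP]
    exact subset_convexHull ℝ _ ⟨w, hw, rfl⟩
  refine five_mul_sum_sq_le hF2 ?_ (sum_sq_le_of_interior (W := h0.toFinset) hF hF2 ?_ ?_ ?_ ?_ ?_)
  · intro x hx
    rw [Set.Finite.mem_toFinset] at *
    exact add_mem_slice_two.2 (hmid x hx x (hsub hx))
  · intro x hx
    rw [Set.Finite.mem_toFinset] at *
    exact hsub hx
  · intro u hu v hv m hm
    rw [Set.Finite.mem_toFinset] at *
    rw [mem_slice_one, latticePoint_eq_midpoint hm]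
    exact hmid u hu v hv
  · intro u hu v hv hd
    rw [Set.Finite.mem_toFinset] at hu hv
    rw [Finset.mem_filter, Set.Finite.mem_toFinset]
    exact ⟨add_mem_slice_two.2 (hmid u hu v hv), hd⟩
  · intro u hu
    rw [Set.Finite.mem_toFinset, mem_slice_one, hP] at hu
    obtain ⟨w, hw, hwu, hle⟩ := exists_ne_le_of_mem_interior ℓ hu
    exact ⟨w, hSP w hw, hwu, by simpa using hle⟩
  · intro u hu
    rw [Set.Finite.mem_toFinset, mem_slice_one, hP] at hu
    obtain ⟨w, hw, hwu, hle⟩ := exists_ne_le_of_mem_interior (-ℓ) hu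
    exact ⟨w, hSP w hw, hwu, by simpa using hle⟩

lemma sliceSum_nonneg (A : Set (Fin 2 → ℝ)) (n : ℕ) : 0 ≤ sliceSum ℓ A n :=
  finsum_mem_induction (0 ≤ ·) le_rfl (fun _ _ => add_nonneg) fun _ _ => sq_nonneg _

/-- The numerator of the generating function of a quartic polynomial vanishing at zero, in terms of
the values of the polynomial at `±1` and `±2`. -/
noncomputable def quarticNumerator (f : ℝ → ℝ) : Polynomial ℝ :=
  Polynomial.monomial 1 (f 1) + Polynomial.monomial 2 (f 2 - 5 * f 1) +
    Polynomial.monomial 3 (f (-2) - 5 * f (-1)) + Polynomial.monomial 4 (f (-1))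

lemma coeff_quarticNumerator (f : ℝ → ℝ) (k : ℕ) : (quarticNumerator f).coeff k =
    (if 1 = k then f 1 else 0) + (if 2 = k then f 2 - 5 * f 1 else 0) +
      (if 3 = k then f (-2) - 5 * f (-1) else 0) + if 4 = k then f (-1) else 0 := by
  simp only [quarticNumerator, Polynomial.coeff_add, Polynomial.coeff_monomial]

/-- The coefficients of the product are fifth differences, which vanish for a quartic from degree
five on. In degrees three and four the terms cut off at negative arguments are what remains, with
opposite sign. -/
lemma coe_quarticNumerator {f : ℝ → ℝ} (hf : IsQuartic f) (hf0 : f 0 = 0) :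
    (quarticNumerator f : PowerSeries ℝ) =
      (1 - PowerSeries.X) ^ 5 * PowerSeries.mk fun n => f n := by
  obtain ⟨c, hc⟩ := hf
  have hc0 : c 0 = 0 := by
    rw [hc] at hf0
    simpa [Fin.sum_univ_five] using hf0
  simp only [Fin.sum_univ_five, hc0] at hc
  simp at hc
  have hexp : (1 - PowerSeries.X : PowerSeries ℝ) ^ 5 * PowerSeries.mk (fun n => f n) =
      PowerSeries.mk (fun n => f n) - 5 • (PowerSeries.mk (fun n => f n) * PowerSeries.X ^ 1)
      + 10 • (PowerSeries.mk (fun n => f n) * PowerSeries.X ^ 2)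
      - 10 • (PowerSeries.mk (fun n => f n) * PowerSeries.X ^ 3)
      + 5 • (PowerSeries.mk (fun n => f n) * PowerSeries.X ^ 4)
      - PowerSeries.mk (fun n => f n) * PowerSeries.X ^ 5 := by
    ring
  rw [hexp]
  ext k
  rw [Polynomial.coeff_coe, coeff_quarticNumerator]
  simp only [map_sub, map_add, map_nsmul, PowerSeries.coeff_mul_X_pow', PowerSeries.coeff_mk]
  rcases Nat.lt_or_ge k 5 with hk | hk
  · interval_cases k <;> norm_num [hc] <;> ring
  · obtain ⟨m, rfl⟩ := Nat.exists_eq_add_of_le' hk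
    have h0 : ∀ j < 5, j ≠ m + 5 := by omega
    have h1 : ∀ j ≤ 5, j ≤ m + 5 := by omega
    rw [if_neg (h0 1 (by norm_num)), if_neg (h0 2 (by norm_num)), if_neg (h0 3 (by norm_num)),
      if_neg (h0 4 (by norm_num)), if_pos (h1 1 (by norm_num)), if_pos (h1 2 (by norm_num)),
      if_pos (h1 3 (by norm_num)), if_pos (h1 4 (by norm_num)), if_pos (h1 5 (by norm_num)),
      show m + 5 - 1 = m + 4 from rfl, show m + 5 - 2 = m + 3 from rfl,
      show m + 5 - 3 = m + 2 from rfl, show m + 5 - 4 = m + 1 from rfl,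
      show m + 5 - 5 = m from rfl]
    simp only [hc, nsmul_eq_mul]
    push_cast
    ring

theorem exists_hStarPolynomial_of_polygon {P : Set (Fin 2 → ℝ)} (hP : IsLatticePolygon P) :
    ∃ h : Polynomial ℝ, IsHStarPolynomial P (fun y => ℓ y ^ 2) 2 h ∧ ∀ k, 0 ≤ h.coeff k := by
  classical
  obtain ⟨⟨S, hSne, hPS⟩, hdim⟩ := hP
  have hPc : Convex ℝ P := hPS ▸ convex_convexHull ℝ _
  have hPb : Bornology.IsBounded P := by
    rw [hPS, isBounded_convexHull]
    exact (S.finite_toSet.image _).isBounded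
  have hSP : ∀ w ∈ S, latticePoint w ∈ P := fun w hw => by
    rw [hPS]; exact subset_convexHull ℝ _ ⟨w, hw, rfl⟩
  have hPne : P.Nonempty := by
    obtain ⟨w, hw⟩ := hSne
    exact ⟨_, hSP w hw⟩
  have hint : (interior P).Nonempty := by
    rw [hPc.interior_nonempty_iff_affineSpan_eq_top,
      AffineSubspace.affineSpan_eq_top_iff_vectorSpan_eq_top_of_nonempty ℝ _ _ hPne]
    refine Submodule.eq_top_of_finrank_eq ?_
    rw [Module.finrank_fin_fun]
    exact hdim
  have hcoe : ((S.image latticePoint : Finset (Fin 2 → ℝ)) : Set (Fin 2 → ℝ)) =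
      latticePoint '' (S : Set (Fin 2 → ℤ)) := Finset.coe_image
  have hcard : 3 ≤ (slice P 1).ncard := by
    have h1 : 3 ≤ S.card := by
      obtain ⟨n, hn⟩ : ∃ n, S.card = n + 1 := Nat.exists_eq_succ_of_ne_zero hSne.card_ne_zero
      have h2 := finrank_vectorSpan_image_finset_le ℝ (latticePoint (d := 2)) S hn
      rw [hcoe, ← direction_affineSpan, ← affineSpan_convexHull, direction_affineSpan, ← hPS] at h2
      have h3 : Module.finrank ℝ (vectorSpan ℝ P) = 2 := hdim
      omega
    rw [← Set.ncard_coe_finset] at h1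
    exact h1.trans (Set.ncard_le_ncard (fun w hw => mem_slice_one.2 (hSP w hw))
      (finite_slice hPb le_rfl))
  have hrec := isReciprocal_convexHull ℓ (S.image latticePoint)
    (fun p hp => by
      obtain ⟨x, -, rfl⟩ := Finset.mem_image.1 hp
      exact ⟨x, rfl⟩)
    (by rw [hcoe, ← hPS]; exact hint)
  rw [hcoe, ← hPS] at hrec
  obtain ⟨f, hf, hf0, hfn⟩ := hrec
  have hseries : ehrhartSeries P (fun y => ℓ y ^ 2) = PowerSeries.mk fun n => f n := by
    unfold ehrhartSeries
    congr 1
    ext n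
    -- `slice` agrees with the dilate only for `n ≥ 1`; the zeroth dilate is the origin, where the
    -- weight vanishes.
    rcases Nat.eq_zero_or_pos n with rfl | hn
    · rw [Nat.cast_zero, hf0]
      refine finsum_mem_eq_zero_of_forall_eq_zero fun x hx => ?_
      have : latticePoint x = 0 := by
        have hx : latticePoint x ∈ ((0 : ℕ) : ℝ) • P := hx
        rwa [Nat.cast_zero, Set.zero_smul_set hPne] at hx
      rw [this]
      have : ((0 : Fin 2 → ℝ), (0 : ℝ)) = 0 := rfl
      simp [this]
    · rw [dilatePoints_eq_slice P hn]
      exact (hfn n hn).1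
  refine ⟨quarticNumerator f, ⟨?_, ?_⟩, fun k => ?_⟩
  · rw [hseries, hdim]
    exact coe_quarticNumerator hf hf0
  · rw [hdim, Polynomial.natDegree_le_iff_coeff_eq_zero]
    intro k hk
    rw [coeff_quarticNumerator, if_neg (by omega), if_neg (by omega), if_neg (by omega),
      if_neg (by omega)]
    simp
  · obtain ⟨a₁, e₁⟩ := hfn 1 le_rfl
    obtain ⟨a₂, e₂⟩ := hfn 2 (by norm_num)
    have h₁ := five_mul_sliceSum_le ℓ hPc hPb hcard
    have h₂ := five_mul_sliceSum_interior_le ℓ hPS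
    have h₃ := sliceSum_nonneg ℓ P 1
    have h₄ := sliceSum_nonneg ℓ (interior P) 1
    norm_num at a₁ e₁ a₂ e₂
    rw [coeff_quarticNumerator]
    refine add_nonneg (add_nonneg (add_nonneg ?_ ?_) ?_) ?_ <;> split_ifs <;> linarith

end Polygon

/-! ### Comparison with the tensor polynomial -/

section Tensor

variable {d : ℕ}

lemma finite_dilatePoints {P : Set (Fin d → ℝ)} (hP : Bornology.IsBounded P) (n : ℕ) :
    (dilatePoints P n).Finite :=
  finite_latticePoint_preimage (hP.smul₀ (n : ℝ))

/-- The value of the quadratic form of a matrix at `v`. -/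
def quadValue (v : Fin d → ℝ) : Matrix (Fin d) (Fin d) ℝ →+ ℝ where
  toFun M := v ⬝ᵥ M.mulVec v
  map_zero' := by simp
  map_add' M N := by simp [Matrix.add_mulVec, dotProduct_add]

lemma coeff_one_sub_X_pow (R : Type*) [Ring R] (N i : ℕ) :
    PowerSeries.coeff i ((1 - PowerSeries.X : PowerSeries R) ^ N) =
      ((PowerSeries.coeff i ((1 - PowerSeries.X : PowerSeries ℤ) ^ N) : ℤ) : R) := by
  have : (1 - PowerSeries.X : PowerSeries R) ^ N =
      PowerSeries.map (Int.castRingHom R) ((1 - PowerSeries.X) ^ N) := by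
    simp
  rw [this, PowerSeries.coeff_map]
  rfl

/-- The coefficients of the product of a power of `1 - X` with a power series are integral
combinations of the coefficients of the latter, so that they commute with additive maps. -/
lemma map_coeff_one_sub_X_pow_mul {A B : Type*} [Ring A] [Ring B] (φ : A →+ B) (N : ℕ)
    (a : ℕ → A) (k : ℕ) :
    φ (PowerSeries.coeff k ((1 - PowerSeries.X) ^ N * PowerSeries.mk a)) =
      PowerSeries.coeff k ((1 - PowerSeries.X) ^ N * PowerSeries.mk fun n => φ (a n)) := by
  simp only [PowerSeries.coeff_mul, map_sum, PowerSeries.coeff_mk]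
  refine Finset.sum_congr rfl fun p _ => ?_
  rw [coeff_one_sub_X_pow A, coeff_one_sub_X_pow B, ← zsmul_eq_mul, ← zsmul_eq_mul, map_zsmul]

lemma quadValue_vecMulVec (v x : Fin d → ℝ) :
    quadValue v (Matrix.vecMulVec x x) = (v ⬝ᵥ x) ^ 2 := by
  simp only [quadValue, AddMonoidHom.coe_mk, ZeroHom.coe_mk, Matrix.vecMulVec_mulVec,
    dotProduct_smul, dotProduct_comm x v]
  simp [sq]

lemma quadValue_coeff {P : Set (Fin d → ℝ)} (hP : Bornology.IsBounded P) (v : Fin d → ℝ)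
    {ℓ : (Fin d → ℝ) →ₗ[ℝ] ℝ} (hℓ : ∀ x, ℓ x = v ⬝ᵥ x) (N k : ℕ) :
    quadValue v (PowerSeries.coeff k ((1 - PowerSeries.X) ^ N * momentTensorSeries P)) =
      PowerSeries.coeff k ((1 - PowerSeries.X) ^ N * ehrhartSeries P fun y => ℓ y.1 ^ 2) := by
  rw [momentTensorSeries, map_coeff_one_sub_X_pow_mul, ehrhartSeries]
  congr 3
  ext n
  rw [AddMonoidHom.map_finsum_mem _ _ (finite_dilatePoints hP n)]
  simp only [quadValue_vecMulVec, hℓ]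

lemma transpose_coeff {P : Set (Fin d → ℝ)} (hP : Bornology.IsBounded P) (N k : ℕ) :
    (PowerSeries.coeff k ((1 - PowerSeries.X) ^ N * momentTensorSeries P)).transpose =
      PowerSeries.coeff k ((1 - PowerSeries.X) ^ N * momentTensorSeries P) := by
  have h := map_coeff_one_sub_X_pow_mul
    (Matrix.transposeAddEquiv (Fin d) (Fin d) ℝ).toAddMonoidHom N
    (fun n => ∑ᶠ x ∈ dilatePoints P n, Matrix.vecMulVec (latticePoint x) (latticePoint x)) k
  rw [momentTensorSeries]
  refine h.trans ?_
  congr 3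
  ext1 n
  rw [AddMonoidHom.map_finsum_mem _ _ (finite_dilatePoints hP n)]
  simp [Matrix.transpose_vecMulVec]

/-- Polarization. It makes the tensor series terminate once every scalar series does. -/
lemma eq_zero_of_quadValue {M : Matrix (Fin d) (Fin d) ℝ} (hM : M.transpose = M)
    (h : ∀ v, quadValue v M = 0) : M = 0 := by
  have hq : ∀ v, v ⬝ᵥ M.mulVec v = 0 := h
  ext i j
  have h1 := hq (Pi.single i 1)
  have h2 := hq (Pi.single j 1)
  have h3 := hq (Pi.single i 1 + Pi.single j 1)
  have h4 : M j i = M i j := congrFun (congrFun hM i) j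
  simp [Matrix.mulVec_add, add_dotProduct, dotProduct_add] at h1 h2 h3
  simp only [Matrix.zero_apply]
  linarith

theorem forall_hStar_nonneg_iff_tensor_posSemidef {P : Set (Fin d → ℝ)}
    (hP : IsLatticePolytope P) :
    (∀ ℓ : (Fin d → ℝ) →ₗ[ℝ] ℝ, ∃ h : Polynomial ℝ,
        IsHStarPolynomial P (fun y => ℓ y.1 ^ 2) 2 h ∧ ∀ k, 0 ≤ h.coeff k) ↔
      ∃ H : Polynomial (Matrix (Fin d) (Fin d) ℝ),
        IsH2TensorPolynomial P H ∧ ∀ k, (H.coeff k).PosSemidef := by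
  obtain ⟨S, -, hPS⟩ := hP
  have hPb : Bornology.IsBounded P := by
    rw [hPS, isBounded_convexHull]
    exact (S.finite_toSet.image _).isBounded
  constructor
  · intro hall
    set Φ := (1 - PowerSeries.X) ^ (polyDim P + 3) * momentTensorSeries P with hΦ
    have hcoeff : ∀ v : Fin d → ℝ, ∃ h : Polynomial ℝ, h.natDegree ≤ polyDim P + 2 ∧
        (∀ k, 0 ≤ h.coeff k) ∧ ∀ k, quadValue v (PowerSeries.coeff k Φ) = h.coeff k := by
      intro v
      -- Every vector `v` is tested through the linear form `x ↦ v ⬝ᵥ x`.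
      obtain ⟨h, ⟨h1, h2⟩, h3⟩ := hall (dotProductBilin ℝ ℝ v)
      refine ⟨h, h2, h3, fun k => ?_⟩
      rw [hΦ, quadValue_coeff hPb v (ℓ := dotProductBilin ℝ ℝ v) (fun x => rfl),
        ← Polynomial.coeff_coe, h1]
    have hpoly : ((PowerSeries.trunc (polyDim P + 3) Φ : Polynomial _) : PowerSeries _) = Φ := by
      ext1 k
      rw [Polynomial.coeff_coe, PowerSeries.coeff_trunc]
      split_ifs with hk
      · rfl
      · refine (eq_zero_of_quadValue (transpose_coeff hPb _ _) fun v => ?_).symm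
        obtain ⟨h, h2, -, h4⟩ := hcoeff v
        rw [h4]
        exact Polynomial.coeff_eq_zero_of_natDegree_lt (by omega)
    refine ⟨PowerSeries.trunc (polyDim P + 3) Φ, ⟨hpoly, ?_⟩, fun k => ?_⟩
    · rw [Polynomial.natDegree_le_iff_coeff_eq_zero]
      intro k hk
      rw [PowerSeries.coeff_trunc, if_neg (by omega)]
    · rw [← Polynomial.coeff_coe, hpoly]
      refine Matrix.PosSemidef.of_dotProduct_mulVec_nonneg ?_ fun v => ?_
      · rw [Matrix.IsHermitian, Matrix.conjTranspose_eq_transpose_of_trivial]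
        exact transpose_coeff hPb _ _
      · obtain ⟨h, -, h3, h4⟩ := hcoeff v
        rw [star_trivial]
        exact (h3 k).trans_eq (h4 k).symm
  · rintro ⟨H, ⟨h1, h2⟩, h3⟩ ℓ
    set v : Fin d → ℝ := fun i => ℓ (Pi.single i 1) with hv
    have hℓ : ∀ x, ℓ x = v ⬝ᵥ x := by
      intro x
      conv_lhs => rw [← Finset.univ_sum_single x]
      rw [map_sum]
      refine Finset.sum_congr rfl fun i _ => ?_
      have : (Pi.single i (x i) : Fin d → ℝ) = x i • Pi.single i 1 := by
        rw [← Pi.single_smul, smul_eq_mul, mul_one]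
      rw [this, map_smul, smul_eq_mul, mul_comm]
    have hc : ∀ k, quadValue v (H.coeff k) = PowerSeries.coeff k
        ((1 - PowerSeries.X) ^ (polyDim P + 3) * ehrhartSeries P fun y => ℓ y.1 ^ 2) := by
      intro k
      rw [← quadValue_coeff hPb v hℓ, ← h1, Polynomial.coeff_coe]
    set Ψ := (1 - PowerSeries.X) ^ (polyDim P + 3) * ehrhartSeries P fun y => ℓ y.1 ^ 2 with hΨ
    have hz : ∀ k, polyDim P + 3 ≤ k → PowerSeries.coeff k Ψ = 0 := by
      intro k hk
      rw [← hc, Polynomial.coeff_eq_zero_of_natDegree_lt (by omega), map_zero]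
    have hpoly : ((PowerSeries.trunc (polyDim P + 3) Ψ : Polynomial ℝ) : PowerSeries ℝ) = Ψ := by
      ext k
      rw [Polynomial.coeff_coe, PowerSeries.coeff_trunc]
      split_ifs with hk
      · rfl
      · exact (hz k (by omega)).symm
    refine ⟨PowerSeries.trunc (polyDim P + 3) Ψ, ⟨hpoly, ?_⟩, fun k => ?_⟩
    · rw [Polynomial.natDegree_le_iff_coeff_eq_zero]
      intro k hk
      rw [PowerSeries.coeff_trunc, if_neg (by omega)]
    · rw [← Polynomial.coeff_coe, hpoly, ← hc]
      have := (h3 k).dotProduct_mulVec_nonneg v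
      rwa [star_trivial] at this

end Tensor

end WeightedEhrhart

open WeightedEhrhart in
/-- The first part allows linear forms on `ℝ² × ℝ`, which are applied to the points `(x, n)`,
`x ∈ nP ∩ ℤ²`, of the cone over `P`; linear forms on `ℝ²` are those ignoring the last
coordinate. -/
theorem theorem3p3 :
    (∀ P : Set (Fin 2 → ℝ), IsLatticePolygon P →
      ∀ ℓ : ((Fin 2 → ℝ) × ℝ) →ₗ[ℝ] ℝ,
        ∃ h : Polynomial ℝ, IsHStarPolynomial P (fun y => ℓ y ^ 2) 2 h ∧ ∀ k, 0 ≤ h.coeff k) ∧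
    (∀ (d : ℕ) (P : Set (Fin d → ℝ)), IsLatticePolytope P →
      ((∀ ℓ : (Fin d → ℝ) →ₗ[ℝ] ℝ,
          ∃ h : Polynomial ℝ,
            IsHStarPolynomial P (fun y => ℓ y.1 ^ 2) 2 h ∧ ∀ k, 0 ≤ h.coeff k) ↔
        ∃ H : Polynomial (Matrix (Fin d) (Fin d) ℝ),
          IsH2TensorPolynomial P H ∧ ∀ k, (H.coeff k).PosSemidef)) := by
  exact ⟨fun P hP ℓ => exists_hStarPolynomial_of_polygon ℓ hP,
    fun d P hP => forall_hStar_nonneg_iff_tensor_posSemidef hP⟩
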